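/- **Theorem 2.3 (Gelfand dualities).** Consider the following categories. * $\mathbf{CH}$: compact Hausdorff spaces and continuous maps. $\mathbf{CH}_{\mathrm{pt}}$: compact Hausdorff spaces with a distinguished point, and continuous maps preserving the point. * $\mathbf{LCH}$: locally compact Hausdorff spaces and continuous maps. $\mathbf{LCH}_{\mathrm{pr}}$: the same spaces, with the continuous maps that are proper (preimages of compact sets are compact). * $\mathbf{C}^*_{1}$: unital commutative $C^*$-algebras and unital $*$-homomorphisms. $\mathbf{C}^*_{1,\mathrm{pt}}$: unital commutative $C^*$-algebras with a distinguished unital $*$-homomorphism to $\mathbb{C}$, and unital $*$-homomorphisms preserving it. * $\mathbf{C}^*_{\mathrm{nd}}$: commutative $C^*$-algebras and $*$-homomorphisms $\Phi\colon A\to B$ that are nondegenerate, i.e. the linear span of $\Phi(A)B$ is dense in $B$. * $\mathbf{C}^*_{\mathrm{mult}}$: commutative $C^*$-algebras; a morphism $\Phi\colon A\to B$ is a $*$-homomorphism $\tilde\Phi\colon A\to M(B)$ into the multiplier algebra (double centralizers) such that the linear span of $\tilde\Phi(A)B$ is dense in $B$. It has a unique extension to a unital $*$-homomorphism $M(\Phi)\colon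 M(A)\to M(B)$, and $\Psi\circ\Phi$ is the unique morphism with $M(\Psi\circ\Phi)=M(\Psi)\circ M(\Phi)$. Consider the following functors. On function algebras they act on morphisms by $f\mapsto f\circ T$, and $\mathrm{Spec}$ acts by $\lambda\mapsto\lambda\circ\Phi$ (composition in the respective category). * $C\colon\mathbf{CH}\to(\mathbf{C}^*_1)^{op}$, $X\mapsto C(X)$; $C\colon\mathbf{CH}_{\mathrm{pt}}\to(\mathbf{C}^*_{1,\mathrm{pt}})^{op}$, where $C(X)$ is pointed by evaluation at the distinguished point; $C_0\colon\mathbf{LCH}_{\mathrm{pr}}\to(\mathbf{C}^*_{\mathrm{nd}})^{op}$ and $C_0\colon\mathbf{LCH}\to(\mathbf{C}^*_{\mathrm{mult}})^{op}$ (continuous functions vanishing at infinity; for the latter, bounded continuous functions act on $C_0(X)$ as multipliers); $C_b\colon\mathbf{LCH}\to(\mathbf{C}^*_1)^{op}$ (bounded continuous functions). * $\mathrm{Spec}$, from the opposite of each of the four $C^*$-categories to $\mathbf{CH}$, $\mathbf{CH}_{\mathrm{pt}}$, $\mathbf{LCH}_{\mathrm{pr}}$, $\mathbf{LCH}$ respectively: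 the space of nonzero $*$-homomorphisms $A\to\mathbb{C}$ with the topology of pointwise convergence, pointed by the distinguished $*$-homomorphism in the pointed case. * The one-point compactification $\mathrm{Alex}\colon\mathbf{LCH}_{\mathrm{pr}}\to\mathbf{CH}_{\mathrm{pt}}$, pointed at $\infty$; the Stone–Čech functor $\beta=\mathrm{Spec}\circ C_b\colon\mathbf{LCH}\to\mathbf{CH}$; the unitization $\mathrm{Unit}\colon\mathbf{C}^*_{\mathrm{nd}}\to\mathbf{C}^*_{1,\mathrm{pt}}$, $A\mapsto A\oplus\mathbb{C}$ with its coordinate map to $\mathbb{C}$; the multiplier functor $M\colon\mathbf{C}^*_{\mathrm{mult}}\to\mathbf{C}^*_1$. * The forgetful functors $\mathbf{CH}_{\mathrm{pt}}\to\mathbf{CH}\to\mathbf{LCH}_{\mathrm{pr}}\to\mathbf{LCH}$ and $\mathbf{C}^*_{1,\mathrm{pt}}\to\mathbf{C}^*_1\to\mathbf{C}^*_{\mathrm{nd}}\to\mathbf{C}^*_{\mathrm{mult}}$, as well as $\mathbf{CH}\to\mathbf{LCH}$ and $\mathbf{C}^*_1\to\mathbf{C}^*_{\mathrm{mult}}$.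 Then these are categories and functors, and the following hold. 1. The four functors $C, C, C_0, C_0$ and the four functors $\mathrm{Spec}$ are full and faithful. The functors $\mathrm{Alex}$, $\beta$, $C_b$, $\mathrm{Unit}^{op}$, $M^{op}$ and (the opposites, on the $C^*$-side, of) all the forgetful functors are faithful; the forgetful functors $\mathbf{CH}\to\mathbf{LCH}_{\mathrm{pr}}$, $\mathbf{CH}\to\mathbf{LCH}$, $\mathbf{C}^*_1\to\mathbf{C}^*_{\mathrm{nd}}$, $\mathbf{C}^*_1\to\mathbf{C}^*_{\mathrm{mult}}$ are also full. 2. (Dualities) In each of the four pairs $(\mathbf{CH}_{\mathrm{pt}},\mathbf{C}^*_{1,\mathrm{pt}})$, $(\mathbf{LCH}_{\mathrm{pr}},\mathbf{C}^*_{\mathrm{nd}})$, $(\mathbf{LCH},\mathbf{C}^*_{\mathrm{mult}})$, $(\mathbf{CH},\mathbf{C}^*_1)$, the functor $C$ or $C_0$ and the functor $\mathrm{Spec}$ form a duality of categories: both composites are naturally isomorphic to the identity functors. 3. (First diagram) Up to natural isomorphism, $C\circ\mathrm{Alex}\cong\mathrm{Unit}\circ C_0$ and $\mathrm{Alex}\circ\mathrm{Spec}\cong\mathrm{Spec}\circ\mathrm{Unit}$;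 the functors $C_0$, and likewise the functors $\mathrm{Spec}$, commute with the forgetful functors $\mathbf{LCH}_{\mathrm{pr}}\to\mathbf{LCH}$ and $\mathbf{C}^*_{\mathrm{nd}}\to\mathbf{C}^*_{\mathrm{mult}}$; and $M\circ C_0\cong C_b\cong C\circ\beta$, $C_b\circ\mathrm{Spec}\cong M$, $\mathrm{Spec}\circ C_b\cong\beta$, $\beta\circ\mathrm{Spec}\cong\mathrm{Spec}\circ M$. 4. (Second diagram) Up to natural isomorphism, the functors $C$, $C$, $C_0$, $C_0$, and likewise the four functors $\mathrm{Spec}$, commute with all the forgetful functors, and the functors $\mathbf{CH}\to\mathbf{LCH}$ and $\mathbf{C}^*_1\to\mathbf{C}^*_{\mathrm{mult}}$ are the composites of the forgetful functors through $\mathbf{LCH}_{\mathrm{pr}}$ and $\mathbf{C}^*_{\mathrm{nd}}$. -/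

import Mathlib

open CategoryTheory Opposite
open scoped ZeroAtInfty BoundedContinuousFunction MultiplierAlgebra

universe u v w x

noncomputable section

namespace GelfandDualities

/-! ### Multiplier algebras of commutative C*-algebras -/

section Multiplier

variable {A : Type u} {B : Type v} {C : Type w} {D : Type x}
  [NonUnitalCommCStarAlgebra A] [NonUnitalCommCStarAlgebra B] [NonUnitalCommCStarAlgebra C]
  [NonUnitalCommCStarAlgebra D]

lemma eq_of_forall_mul_eq {y z : A} (h : ∀ x : A, x * y = x * z) : y = z := by
  rw [← sub_eq_zero, ← CStarRing.star_mul_self_eq_zero_iff, mul_sub, sub_eq_zero]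
  exact h _

lemma fst_eq_snd (m : 𝓜(ℂ, A)) (x : A) : m.fst x = m.snd x :=
  eq_of_forall_mul_eq fun z => by
    have h1 := m.central z x
    have h2 : m.snd (z * x) = z * m.snd x := eq_of_forall_mul_eq fun w => by
      rw [mul_comm w, m.central, mul_comm w, mul_assoc, mul_assoc, m.central x w]
    have h3 : m.snd (x * z) = x * m.snd z := eq_of_forall_mul_eq fun w => by
      rw [mul_comm w, m.central, mul_comm w, mul_assoc, mul_assoc, m.central z w]
    rw [← h1, ← h2, mul_comm z x, h3, mul_comm]

lemma fst_mul (m : 𝓜(ℂ, A)) (x y : A) : m.fst (x * y) = m.fst x * y :=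
  eq_of_forall_mul_eq fun z => by
    rw [← m.central, ← mul_assoc, m.central, mul_assoc]

lemma mul_fst_comm (m : 𝓜(ℂ, A)) (x y : A) : m.fst (x * y) = x * m.fst y := by
  rw [mul_comm x, fst_mul, mul_comm]

lemma star_fst' (m : 𝓜(ℂ, A)) (x : A) : (star m).fst x = star (m.fst (star x)) := by
  rw [fst_eq_snd m]; rfl

lemma multiplier_ext {m n : 𝓜(ℂ, A)} (h : ∀ x, m.fst x = n.fst x) : m = n := by
  refine DoubleCentralizer.ext _ _ _ _ (Prod.ext (ContinuousLinearMap.ext h) ?_)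
  refine ContinuousLinearMap.ext fun x => ?_
  rw [← fst_eq_snd, ← fst_eq_snd, h]

/-- The multiplier algebra of a commutative C*-algebra is a commutative unital C*-algebra. -/
instance : CommCStarAlgebra 𝓜(ℂ, A) where
  __ := (inferInstance : CStarAlgebra 𝓜(ℂ, A))
  mul_comm m n := multiplier_ext fun x => eq_of_forall_mul_eq fun z => by
    change z * m.fst (n.fst x) = z * n.fst (m.fst x)
    rw [← mul_fst_comm m, fst_mul m, ← mul_fst_comm n z, ← mul_fst_comm m, fst_mul m,
      mul_fst_comm n]

/-- An operator commuting with multiplications, as a double centralizer. -/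
def multiplierOfCLM (T : A →L[ℂ] A) (hT : ∀ x y, T (x * y) = T x * y) : 𝓜(ℂ, A) where
  fst := T
  snd := T
  central x y := by rw [← hT, mul_comm x, hT, mul_comm]

lemma exists_approximateUnit (A : Type u) [NonUnitalCommCStarAlgebra A] :
    ∃ l : Filter A, l.NeBot ∧ (∀ a : A, Filter.Tendsto (fun e => e * a) l (nhds a)) ∧
      ∀ᶠ e in l, ‖e‖ ≤ 1 := by
  let _ := CStarAlgebra.spectralOrder A
  have := CStarAlgebra.spectralOrderedRing A
  have h := CStarAlgebra.increasingApproximateUnit A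
  exact ⟨_, h.neBot, h.tendsto_mul_right, h.eventually_norm⟩

/-- Non-degeneracy of a map `Φ : A → 𝓜(B)`: the linear span of
`{Φ(a)b : a ∈ A, b ∈ B}` is dense in `B`. -/
def IsNondegenerate (Φ : A →⋆ₙₐ[ℂ] 𝓜(ℂ, B)) : Prop :=
  Dense (Submodule.span ℂ {y : B | ∃ (a : A) (b : B), (Φ a).fst b = y} : Set B)

lemma IsNondegenerate.clm_ext {Φ : A →⋆ₙₐ[ℂ] 𝓜(ℂ, B)} (hΦ : IsNondegenerate Φ)
    {S T : B →L[ℂ] B} (h : ∀ a b, S ((Φ a).fst b) = T ((Φ a).fst b)) : S = T := by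
  refine ContinuousLinearMap.ext_on hΦ ?_
  rintro _ ⟨a, b, rfl⟩
  exact h a b

lemma IsNondegenerate.exists_clm {Φ : A →⋆ₙₐ[ℂ] 𝓜(ℂ, B)} (hΦ : IsNondegenerate Φ)
    (m : 𝓜(ℂ, A)) :
    ∃ T : B →L[ℂ] B, ∀ a b, T ((Φ a).fst b) = (Φ (m.fst a)).fst b := by
  obtain ⟨l, hl, hlim, hbd⟩ := exists_approximateUnit A
  set S : Submodule ℂ B := Submodule.span ℂ {y : B | ∃ (a : A) (b : B), (Φ a).fst b = y} with hS
  have hΦc : Continuous Φ :=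
    AddMonoidHomClass.continuous_of_bound Φ 1 fun a => by
      simpa using NonUnitalStarAlgHom.norm_apply_le Φ a
  -- on generators the net `Φ(m e)` converges
  have hgen : ∀ a b, Filter.Tendsto (fun e => (Φ (m.fst e)).fst ((Φ a).fst b)) l
      (nhds ((Φ (m.fst a)).fst b)) := fun a b => by
    have h1 : ∀ e, (Φ (m.fst e)).fst ((Φ a).fst b) = (Φ (m.fst (e * a))).fst b := fun e => by
      rw [fst_mul, map_mul]; rfl
    simp_rw [h1]
    have h2 : Continuous fun a' : A => (Φ (m.fst a')).fst b := by
      have h3 : Continuous fun n : 𝓜(ℂ, B) => n.fst b := by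
        refine (LipschitzWith.of_dist_le_mul (K := ‖b‖₊) fun n n' => ?_).continuous
        rw [dist_eq_norm, dist_eq_norm, mul_comm, ← DoubleCentralizer.norm_fst (n - n')]
        exact (n - n').fst.le_opNorm b
      exact h3.comp (hΦc.comp m.fst.continuous)
    exact (h2.tendsto a).comp (hlim a)
  have hex : ∀ x : S, ∃ y, Filter.Tendsto (fun e => (Φ (m.fst e)).fst (x : B)) l (nhds y) := by
    rintro ⟨x, hx⟩
    refine Submodule.span_induction (p := fun x _ => ∃ y,
      Filter.Tendsto (fun e => (Φ (m.fst e)).fst x) l (nhds y)) ?_ ?_ ?_ ?_ hx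
    · rintro _ ⟨a, b, rfl⟩
      exact ⟨_, hgen a b⟩
    · exact ⟨0, by simp⟩
    · rintro x y _ _ ⟨x', hx'⟩ ⟨y', hy'⟩
      exact ⟨x' + y', by simpa using hx'.add hy'⟩
    · rintro c x _ ⟨x', hx'⟩
      exact ⟨c • x', by simpa using hx'.const_smul c⟩
  choose f hf using hex
  let F : S →ₗ[ℂ] B :=
    { toFun := f
      map_add' := fun x y => tendsto_nhds_unique (hf _) (by simpa using (hf x).add (hf y))
      map_smul' := fun c x => tendsto_nhds_unique (hf _) (by simpa using (hf x).const_smul c) }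
  have hF : ∀ x, ‖F x‖ ≤ ‖m‖ * ‖x‖ := fun x => by
    refine le_of_tendsto (hf x).norm (hbd.mono fun e he => ?_)
    refine ((Φ (m.fst e)).fst.le_opNorm _).trans ?_
    refine mul_le_mul_of_nonneg_right ?_ (norm_nonneg _)
    rw [DoubleCentralizer.norm_fst]
    refine (NonUnitalStarAlgHom.norm_apply_le Φ _).trans ((m.fst.le_opNorm e).trans ?_)
    rw [DoubleCentralizer.norm_fst]
    exact mul_le_of_le_one_right (norm_nonneg _) he
  refine ⟨(F.mkContinuous ‖m‖ hF).extend S.subtypeL, fun a b => ?_⟩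
  have hmem : (Φ a).fst b ∈ S := Submodule.subset_span ⟨a, b, rfl⟩
  have := ContinuousLinearMap.extend_eq (f := F.mkContinuous ‖m‖ hF) (e := S.subtypeL)
    hΦ.denseRange_val isUniformEmbedding_subtype_val.isUniformInducing ⟨_, hmem⟩
  refine this.trans (tendsto_nhds_unique (hf _) (hgen a b))

/-- A non-degenerate *-homomorphism `A → 𝓜(B)` has a unique extension to a unital
*-homomorphism `𝓜(A) → 𝓜(B)`. -/
theorem IsNondegenerate.existsUnique_extension {Φ : A →⋆ₙₐ[ℂ] 𝓜(ℂ, B)} (hΦ : IsNondegenerate Φ) :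
    ∃! Ψ : 𝓜(ℂ, A) →⋆ₐ[ℂ] 𝓜(ℂ, B), ∀ a : A, Ψ (DoubleCentralizer.coeHom a) = Φ a := by
  choose T hT using hΦ.exists_clm
  have hmul : ∀ m x y, T m (x * y) = T m x * y := fun m x y => by
    have : (T m).comp ((ContinuousLinearMap.mul ℂ B).flip y) =
        ((ContinuousLinearMap.mul ℂ B).flip y).comp (T m) := hΦ.clm_ext fun a b => by
      change T m ((Φ a).fst b * y) = T m ((Φ a).fst b) * y
      rw [← fst_mul, hT, hT, fst_mul]
    exact congrArg (fun S : B →L[ℂ] B => S x) this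
  have hone : T 1 = 1 := hΦ.clm_ext fun a b => by rw [hT]; rfl
  have hTmul : ∀ m n, T (m * n) = T m * T n := fun m n => hΦ.clm_ext fun a b => by
    change _ = T m (T n _)
    rw [hT, hT, hT]; rfl
  have hadd : ∀ m n, T (m + n) = T m + T n := fun m n => hΦ.clm_ext fun a b => by
    change _ = T m _ + T n _
    rw [hT, hT, hT]
    change (Φ (m.fst a + n.fst a)).fst b = _
    rw [map_add]; rfl
  have hsmul : ∀ (c : ℂ) m, T (c • m) = c • T m := fun c m => hΦ.clm_ext fun a b => by
    change _ = c • T m _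
    rw [hT, hT]
    change (Φ (c • m.fst a)).fst b = _
    rw [map_smul]; rfl
  have hstar : ∀ m x, T (star m) x = star (T m (star x)) := fun m x => by
    have : T (star m) = (((starₗᵢ ℂ : B ≃ₗᵢ⋆[ℂ] B) : B →L⋆[ℂ] B).comp (T m)).comp
          ((starₗᵢ ℂ : B ≃ₗᵢ⋆[ℂ] B) : B →L⋆[ℂ] B) := hΦ.clm_ext fun a b => by
      change _ = star (T m (star _))
      have h1 : star ((Φ a).fst b) = (Φ (star a)).fst (star b) := by
        rw [map_star Φ, star_fst', star_star]
      rw [h1, hT, hT, star_fst', map_star Φ, star_fst']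
    rw [this]; rfl
  let Ψ : 𝓜(ℂ, A) →⋆ₐ[ℂ] 𝓜(ℂ, B) :=
    { toFun := fun m => multiplierOfCLM (T m) (hmul m)
      map_one' := multiplier_ext fun x => by change T 1 x = x; rw [hone]; rfl
      map_mul' := fun m n => multiplier_ext fun x => by
        change T (m * n) x = T m (T n x); rw [hTmul]; rfl
      map_zero' := multiplier_ext fun x => by
        change T 0 x = 0
        have := hsmul 0 0
        rw [zero_smul, zero_smul] at this
        rw [this]; rfl
      map_add' := fun m n => multiplier_ext fun x => by
        change T (m + n) x = T m x + T n x; rw [hadd]; rfl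
      commutes' := fun c => multiplier_ext fun x => by
        rw [Algebra.algebraMap_eq_smul_one, Algebra.algebraMap_eq_smul_one]
        change T (c • 1) x = c • x
        rw [hsmul, hone]; rfl
      map_star' := fun m => multiplier_ext fun x => by
        rw [star_fst']
        exact hstar m x }
  refine ⟨Ψ, fun a => multiplier_ext fun x => ?_, fun Ψ' hΨ' => ?_⟩
  · have : T (DoubleCentralizer.coeHom a) = (Φ a).fst := hΦ.clm_ext fun a' b => by
      rw [hT]
      change (Φ (a * a')).fst b = _
      rw [map_mul]; rfl
    exact congrArg (fun S : B →L[ℂ] B => S x) this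
  · refine StarAlgHom.ext fun m => multiplier_ext fun x => ?_
    have : (Ψ' m).fst = T m := hΦ.clm_ext fun a b => by
      rw [hT, ← hΨ', ← hΨ']
      have h2 : (DoubleCentralizer.coeHom (m.fst a) : 𝓜(ℂ, A)) =
          m * DoubleCentralizer.coeHom a := multiplier_ext fun y => (fst_mul m a y).symm
      rw [h2, map_mul]; rfl
    exact congrArg (fun S : B →L[ℂ] B => S x) this

/-- The unique unital extension `𝓜(A) → 𝓜(B)` of a non-degenerate *-homomorphism `A → 𝓜(B)`. -/
def IsNondegenerate.extension {Φ : A →⋆ₙₐ[ℂ] 𝓜(ℂ, B)} (hΦ : IsNondegenerate Φ) :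
    𝓜(ℂ, A) →⋆ₐ[ℂ] 𝓜(ℂ, B) :=
  hΦ.existsUnique_extension.choose

lemma IsNondegenerate.extension_coe {Φ : A →⋆ₙₐ[ℂ] 𝓜(ℂ, B)} (hΦ : IsNondegenerate Φ) (a : A) :
    hΦ.extension (DoubleCentralizer.coeHom a) = Φ a :=
  hΦ.existsUnique_extension.choose_spec.1 a

lemma IsNondegenerate.extension_unique {Φ : A →⋆ₙₐ[ℂ] 𝓜(ℂ, B)} (hΦ : IsNondegenerate Φ)
    {Ψ : 𝓜(ℂ, A) →⋆ₐ[ℂ] 𝓜(ℂ, B)} (h : ∀ a, Ψ (DoubleCentralizer.coeHom a) = Φ a) :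
    hΦ.extension = Ψ :=
  (hΦ.existsUnique_extension.choose_spec.2 Ψ h).symm

/-- `𝓜(Φ)(m) Φ(a)b = Φ(ma)b`. -/
lemma IsNondegenerate.extension_apply {Φ : A →⋆ₙₐ[ℂ] 𝓜(ℂ, B)} (hΦ : IsNondegenerate Φ)
    (m : 𝓜(ℂ, A)) (a : A) (b : B) :
    (hΦ.extension m).fst ((Φ a).fst b) = (Φ (m.fst a)).fst b := by
  have h2 : (DoubleCentralizer.coeHom (m.fst a) : 𝓜(ℂ, A)) =
      m * DoubleCentralizer.coeHom a := multiplier_ext fun y => (fst_mul m a y).symm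
  rw [← hΦ.extension_coe, ← hΦ.extension_coe, h2, map_mul]; rfl

lemma dense_span_mul (A : Type u) [NonUnitalCommCStarAlgebra A] :
    Dense (Submodule.span ℂ {y : A | ∃ a b : A, a * b = y} : Set A) := fun a => by
  obtain ⟨l, hl, hlim, -⟩ := exists_approximateUnit A
  exact mem_closure_of_tendsto (hlim a)
    (Filter.Eventually.of_forall fun e => Submodule.subset_span ⟨e, a, rfl⟩)

lemma isNondegenerate_coeHom (A : Type u) [NonUnitalCommCStarAlgebra A] :
    IsNondegenerate (DoubleCentralizer.coeHom : A →⋆ₙₐ[ℂ] 𝓜(ℂ, A)) :=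
  dense_span_mul A

/-- A morphism `A → B` in the multiplier-valued category: a non-degenerate
*-homomorphism `A → 𝓜(B)`. -/
@[ext]
structure MultHom (A : Type u) (B : Type v) [NonUnitalCommCStarAlgebra A]
    [NonUnitalCommCStarAlgebra B] where
  toHom : A →⋆ₙₐ[ℂ] 𝓜(ℂ, B)
  nondegenerate : IsNondegenerate toHom

namespace MultHom

/-- The unital extension `𝓜(A) → 𝓜(B)` of a multiplier-valued morphism. -/
def mult (Φ : MultHom A B) : 𝓜(ℂ, A) →⋆ₐ[ℂ] 𝓜(ℂ, B) := Φ.nondegenerate.extension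

lemma mult_coe (Φ : MultHom A B) (a : A) : Φ.mult (DoubleCentralizer.coeHom a) = Φ.toHom a :=
  Φ.nondegenerate.extension_coe a

lemma mult_unique (Φ : MultHom A B) {Ψ : 𝓜(ℂ, A) →⋆ₐ[ℂ] 𝓜(ℂ, B)}
    (h : ∀ a, Ψ (DoubleCentralizer.coeHom a) = Φ.toHom a) : Φ.mult = Ψ :=
  Φ.nondegenerate.extension_unique h

variable (A) in
/-- The identity of `A` is the inclusion `A → 𝓜(A)`. -/
def id : MultHom A A := ⟨DoubleCentralizer.coeHom, isNondegenerate_coeHom A⟩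

/-- The composition `A → B → C` is the *-homomorphism `𝓜(Ψ) ∘ Φ : A → 𝓜(C)`. -/
def comp (Ψ : MultHom B C) (Φ : MultHom A B) : MultHom A C where
  toHom := (Ψ.mult : 𝓜(ℂ, B) →⋆ₙₐ[ℂ] 𝓜(ℂ, C)).comp Φ.toHom
  nondegenerate := by
    unfold IsNondegenerate
    set S := Submodule.span ℂ {y : C | ∃ (a : A) (b : C),
      (((Ψ.mult : 𝓜(ℂ, B) →⋆ₙₐ[ℂ] 𝓜(ℂ, C)).comp Φ.toHom) a).fst b = y}
    have h1 : ∀ (b : B) (c : C), (Ψ.toHom b).fst c ∈ S.topologicalClosure := fun b c => by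
      have hc : Continuous fun b : B => (Ψ.toHom b).fst c := by
        have h3 : Continuous fun n : 𝓜(ℂ, C) => n.fst c := by
          refine (LipschitzWith.of_dist_le_mul (K := ‖c‖₊) fun n n' => ?_).continuous
          rw [dist_eq_norm, dist_eq_norm, mul_comm, ← DoubleCentralizer.norm_fst (n - n')]
          exact (n - n').fst.le_opNorm c
        exact h3.comp (AddMonoidHomClass.continuous_of_bound Ψ.toHom 1 fun a => by
          simpa using NonUnitalStarAlgHom.norm_apply_le Ψ.toHom a)
      have hcl : IsClosed {b : B | (Ψ.toHom b).fst c ∈ S.topologicalClosure} :=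
        S.isClosed_topologicalClosure.preimage hc
      have hsub : ((Submodule.span ℂ {y : B | ∃ (a : A) (b : B), (Φ.toHom a).fst b = y} :
          Submodule ℂ B) : Set B) ⊆ {b : B | (Ψ.toHom b).fst c ∈ S.topologicalClosure} := by
        intro b hb
        refine Submodule.span_induction (p := fun b _ =>
          (Ψ.toHom b).fst c ∈ S.topologicalClosure) ?_ ?_ ?_ ?_ hb
        · rintro _ ⟨a, b, rfl⟩
          refine S.le_topologicalClosure (Submodule.subset_span ⟨a, (Ψ.toHom b).fst c, ?_⟩)
          exact Ψ.nondegenerate.extension_apply (Φ.toHom a) b c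
        · rw [map_zero]; exact zero_mem _
        · intro x y _ _ hx hy
          rw [map_add]; exact add_mem hx hy
        · intro r x _ hx
          rw [map_smul]; exact Submodule.smul_mem _ r hx
      exact closure_minimal hsub hcl (Φ.nondegenerate b)
    intro c
    have hle : Submodule.span ℂ {y : C | ∃ (a : B) (b : C), (Ψ.toHom a).fst b = y} ≤
        S.topologicalClosure := by
      rw [Submodule.span_le]
      rintro _ ⟨b, c, rfl⟩
      exact h1 b c
    exact closure_minimal hle S.isClosed_topologicalClosure (Ψ.nondegenerate c)

/-- The law characterising the composition: `𝓜(Ψ ∘ Φ) = 𝓜(Ψ) ∘ 𝓜(Φ)`. -/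
lemma mult_comp (Ψ : MultHom B C) (Φ : MultHom A B) :
    (Ψ.comp Φ).mult = Ψ.mult.comp Φ.mult :=
  mult_unique _ fun a => congrArg Ψ.mult (Φ.mult_coe a)

lemma mult_id : (MultHom.id A).mult = StarAlgHom.id ℂ 𝓜(ℂ, A) :=
  mult_unique _ fun _ => rfl

lemma comp_id (Φ : MultHom A B) : Φ.comp (MultHom.id A) = Φ :=
  MultHom.ext (NonUnitalStarAlgHom.ext fun a => Φ.mult_coe a)

lemma id_comp (Φ : MultHom A B) : (MultHom.id B).comp Φ = Φ :=
  MultHom.ext (NonUnitalStarAlgHom.ext fun a => by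
    change (MultHom.id B).mult (Φ.toHom a) = _
    rw [mult_id]; rfl)

lemma comp_assoc (Χ : MultHom C D) (Ψ : MultHom B C) (Φ : MultHom A B) :
    (Χ.comp Ψ).comp Φ = Χ.comp (Ψ.comp Φ) :=
  MultHom.ext (NonUnitalStarAlgHom.ext fun a => by
    change (Χ.comp Ψ).mult (Φ.toHom a) = Χ.mult (Ψ.mult (Φ.toHom a))
    rw [mult_comp]; rfl)

end MultHom

end Multiplier

/-! ### Non-degenerate *-homomorphisms -/

section Nd

variable {A : Type u} {B : Type v} {C : Type w}
  [NonUnitalCommCStarAlgebra A] [NonUnitalCommCStarAlgebra B] [NonUnitalCommCStarAlgebra C]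

/-- A non-degenerate *-homomorphism `Φ : A → B`: the linear span of
`{Φ(a)b : a ∈ A, b ∈ B}` is dense in `B`. -/
@[ext]
structure NdHom (A : Type u) (B : Type v) [NonUnitalCommCStarAlgebra A]
    [NonUnitalCommCStarAlgebra B] where
  toHom : A →⋆ₙₐ[ℂ] B
  nondegenerate : Dense (Submodule.span ℂ {y : B | ∃ (a : A) (b : B), toHom a * b = y} : Set B)

namespace NdHom

/-- A non-degenerate *-homomorphism `A → B`, viewed as a multiplier-valued morphism through
the inclusion `B → 𝓜(B)`. -/
def toMultHom (Φ : NdHom A B) : MultHom A B where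
  toHom := (DoubleCentralizer.coeHom : B →⋆ₙₐ[ℂ] 𝓜(ℂ, B)).comp Φ.toHom
  nondegenerate := Φ.nondegenerate

variable (A) in
/-- The identity morphism. -/
def id : NdHom A A := ⟨NonUnitalStarAlgHom.id ℂ A, dense_span_mul A⟩

lemma toMultHom_comp_toHom (Ψ : NdHom B C) (Φ : NdHom A B) :
    (Ψ.toMultHom.comp Φ.toMultHom).toHom =
      (DoubleCentralizer.coeHom : C →⋆ₙₐ[ℂ] 𝓜(ℂ, C)).comp (Ψ.toHom.comp Φ.toHom) :=
  NonUnitalStarAlgHom.ext fun a => Ψ.toMultHom.mult_coe (Φ.toHom a)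

/-- The usual composition. -/
def comp (Ψ : NdHom B C) (Φ : NdHom A B) : NdHom A C where
  toHom := Ψ.toHom.comp Φ.toHom
  nondegenerate := by
    have h := (Ψ.toMultHom.comp Φ.toMultHom).nondegenerate
    rw [toMultHom_comp_toHom] at h
    exact h

end NdHom

end Nd

/-! ### Spectra -/

section Spectrum

open WeakDual

variable {A : Type u} {B : Type v} {C : Type w}
  [NonUnitalCommCStarAlgebra A] [NonUnitalCommCStarAlgebra B] [NonUnitalCommCStarAlgebra C]

lemma character_star (φ : characterSpace ℂ A) (a : A) : φ (star a) = star (φ a) := by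
  have h := map_star (Unitization.lift (CharacterSpace.toNonUnitalAlgHom φ)) (a : Unitization ℂ A)
  rw [← Unitization.inr_star] at h
  simpa using h

/-- A character of `A` as a *-homomorphism `A → ℂ`. -/
def characterStarHom (φ : characterSpace ℂ A) : A →⋆ₙₐ[ℂ] ℂ where
  __ := CharacterSpace.toNonUnitalAlgHom φ
  map_star' := character_star φ

lemma exists_character_ne_zero (φ : characterSpace ℂ A) : ∃ a, φ a ≠ 0 := by
  by_contra! h
  exact φ.2.1 (ContinuousLinearMap.ext h)

lemma ndHom_character_ne_zero (φ : NdHom A ℂ) : ∃ a, φ.toHom a ≠ 0 := by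
  by_contra! h
  have h2 : (Submodule.span ℂ {y : ℂ | ∃ (a : A) (b : ℂ), φ.toHom a * b = y}) = ⊥ := by
    rw [Submodule.span_eq_bot]
    rintro _ ⟨a, b, rfl⟩
    rw [h, zero_mul]
  have h3 := φ.nondegenerate
  rw [h2] at h3
  have h4 := h3.closure_eq
  simp only [Submodule.bot_coe, closure_singleton] at h4
  exact one_ne_zero (show (1 : ℂ) ∈ ({0} : Set ℂ) from h4 ▸ Set.mem_univ _)

/-- Characters of `A` (non-zero multiplicative functionals) are the same thing as non-degenerate
*-homomorphisms `A → ℂ`. -/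
def characterEquivNdHom : characterSpace ℂ A ≃ NdHom A ℂ where
  toFun φ :=
    { toHom := characterStarHom φ
      nondegenerate := by
        obtain ⟨a, ha⟩ := exists_character_ne_zero φ
        intro z
        refine subset_closure (Submodule.subset_span ⟨a, (φ a)⁻¹ * z, ?_⟩)
        change φ a * _ = z
        field_simp }
  invFun φ := ⟨⟨(φ.toHom : A →ₗ[ℂ] ℂ), AddMonoidHomClass.continuous_of_bound φ.toHom 1 fun a => by
      simpa using NonUnitalStarAlgHom.norm_apply_le φ.toHom a⟩, by
    obtain ⟨a, ha⟩ := ndHom_character_ne_zero φ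
    exact ⟨fun h => ha (congrArg (fun f : WeakDual ℂ A => f a) h), map_mul φ.toHom⟩⟩
  left_inv _ := rfl
  right_inv _ := rfl

/-- Multiplier-valued morphisms `A → ℂ` are the same thing as non-degenerate *-homomorphisms
`A → ℂ`, since `𝓜(ℂ) = ℂ`. -/
def ndHomEquivMultHom : NdHom A ℂ ≃ MultHom A ℂ where
  toFun φ := φ.toMultHom
  invFun φ :=
    { toHom :=
        { toFun := fun a => (φ.toHom a).fst 1
          map_smul' := fun c a => by rw [map_smul]; rfl
          map_zero' := by rw [map_zero]; rfl
          map_add' := fun a b => by rw [map_add]; rfl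
          map_mul' := fun a b => by
            rw [map_mul]
            change (φ.toHom a).fst ((φ.toHom b).fst 1) = _
            rw [← fst_mul, one_mul]
          map_star' := fun a => by rw [map_star, star_fst', star_one] }
      nondegenerate := by
        refine φ.nondegenerate.mono fun z hz => Submodule.span_mono ?_ hz
        rintro _ ⟨a, b, rfl⟩
        refine ⟨a, b, ?_⟩
        change (φ.toHom a).fst 1 * b = _
        rw [← fst_mul, one_mul] }
  left_inv φ := NdHom.ext (NonUnitalStarAlgHom.ext fun a => mul_one _)
  right_inv φ := MultHom.ext (NonUnitalStarAlgHom.ext fun a => multiplier_ext fun z => by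
    change (φ.toHom a).fst 1 * z = _
    rw [← fst_mul, one_mul])

/-- The spectrum of `A` as the set of multiplier-valued morphisms `A → ℂ`. -/
def characterEquivMultHom : characterSpace ℂ A ≃ MultHom A ℂ :=
  characterEquivNdHom.trans ndHomEquivMultHom

lemma continuous_eval_character (a : A) : Continuous fun φ : characterSpace ℂ A => φ a :=
  (WeakDual.eval_continuous a).comp continuous_subtype_val

lemma isCompact_character_le (a : A) {δ : ℝ} (hδ : 0 < δ) :
    IsCompact {φ : characterSpace ℂ A | δ ≤ ‖φ a‖} := by
  rw [Topology.IsEmbedding.subtypeVal.isCompact_iff]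
  have h1 : (Subtype.val '' {φ : characterSpace ℂ A | δ ≤ ‖φ a‖}) =
      (characterSpace ℂ A ∪ {0}) ∩ {φ : WeakDual ℂ A | δ ≤ ‖φ a‖} := by
    ext φ
    constructor
    · rintro ⟨φ, h, rfl⟩
      exact ⟨Or.inl φ.2, h⟩
    · rintro ⟨h1 | rfl, h2⟩
      · exact ⟨⟨φ, h1⟩, h2, rfl⟩
      · have h3 : δ ≤ ‖(0 : ℂ)‖ := h2
        rw [norm_zero] at h3
        exact absurd h3 (not_le.2 hδ)
  rw [h1]
  refine IsCompact.of_isClosed_subset (WeakDual.isCompact_closedBall (𝕜 := ℂ) (E := A) 0 1)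
    ((CharacterSpace.union_zero_isClosed ℂ A).inter
      (isClosed_le continuous_const (WeakDual.eval_continuous a).norm)) ?_
  rintro φ ⟨h1 | rfl, h2⟩
  · simp only [Set.mem_preimage, mem_closedBall_zero_iff]
    refine ContinuousLinearMap.opNorm_le_bound _ zero_le_one fun a => ?_
    rw [one_mul]
    exact NonUnitalStarAlgHom.norm_apply_le (characterStarHom ⟨φ, h1⟩) a
  · simp

instance : LocallyCompactSpace (characterSpace ℂ A) := by
  have : WeaklyLocallyCompactSpace (characterSpace ℂ A) := ⟨fun φ => by
    obtain ⟨a, ha⟩ := exists_character_ne_zero φ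
    refine ⟨_, isCompact_character_le a (half_pos (norm_pos_iff.2 ha)), ?_⟩
    refine Filter.mem_of_superset ((isOpen_lt continuous_const
      (continuous_eval_character a).norm).mem_nhds (half_lt_self (norm_pos_iff.2 ha))) ?_
    exact fun ψ hψ => le_of_lt (show ‖φ a‖ / 2 < ‖ψ a‖ from hψ)⟩
  infer_instance

/-- `Spec(Φ)(λ) = λ ∘ Φ` for a multiplier-valued morphism `Φ`, where the composition is that of
multiplier-valued morphisms. -/
def specMultFun (Φ : MultHom A B) (φ : characterSpace ℂ B) : characterSpace ℂ A :=
  characterEquivMultHom.symm ((characterEquivMultHom φ).comp Φ)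

lemma specMultFun_apply (Φ : MultHom A B) (φ : characterSpace ℂ B) (a : A) (b : B) :
    specMultFun Φ φ a * φ b = φ ((Φ.toHom a).fst b) := by
  have h := (characterEquivMultHom φ).nondegenerate.extension_apply (Φ.toHom a) b 1
  have h1 : ((characterEquivMultHom φ).toHom ((Φ.toHom a).fst b)).fst 1 =
    φ ((Φ.toHom a).fst b) := mul_one _
  have h2 : ((characterEquivMultHom φ).toHom b).fst 1 = φ b := mul_one _
  rw [h1, h2] at h
  rw [← h]
  change ((characterEquivMultHom φ).mult (Φ.toHom a)).fst 1 * φ b = _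
  rw [← fst_mul, one_mul]
  rfl

/-- The continuous map `Spec(Φ)` of a multiplier-valued morphism. -/
def specMultMap (Φ : MultHom A B) : C(characterSpace ℂ B, characterSpace ℂ A) where
  toFun := specMultFun Φ
  continuous_toFun := by
    refine Continuous.subtype_mk (WeakDual.continuous_of_continuous_eval fun a => ?_) _
    change Continuous fun φ => specMultFun Φ φ a
    rw [continuous_iff_continuousAt]
    intro φ
    obtain ⟨b, hb⟩ := exists_character_ne_zero φ
    have h1 : (fun ψ : characterSpace ℂ B => ψ ((Φ.toHom a).fst b) / ψ b) =ᶠ[nhds φ]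
        fun ψ => specMultFun Φ ψ a := by
      filter_upwards [(isOpen_ne_fun (continuous_eval_character b) continuous_const).mem_nhds hb]
        with ψ hψ
      rw [← specMultFun_apply, mul_div_assoc, div_self hψ, mul_one]
    exact ContinuousAt.congr ((continuous_eval_character _).continuousAt.div
      (continuous_eval_character b).continuousAt hb) h1

lemma specMultMap_id : specMultMap (MultHom.id A) = ContinuousMap.id _ :=
  ContinuousMap.ext fun φ => by
    change characterEquivMultHom.symm (MultHom.comp _ _) = φ
    rw [MultHom.comp_id, Equiv.symm_apply_apply]

lemma specMultMap_comp (Ψ : MultHom B C) (Φ : MultHom A B) :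
    specMultMap (Ψ.comp Φ) = (specMultMap Φ).comp (specMultMap Ψ) :=
  ContinuousMap.ext fun φ => by
    change characterEquivMultHom.symm (MultHom.comp _ _) =
      characterEquivMultHom.symm (MultHom.comp (characterEquivMultHom
        (characterEquivMultHom.symm (MultHom.comp _ _))) _)
    rw [Equiv.apply_symm_apply, MultHom.comp_assoc]

/-- The continuous map `Spec(Φ)(λ) = λ ∘ Φ` of a non-degenerate *-homomorphism `Φ`. -/
def specNdMap (Φ : NdHom A B) : C(characterSpace ℂ B, characterSpace ℂ A) where
  toFun φ := characterEquivNdHom.symm ((characterEquivNdHom φ).comp Φ)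
  continuous_toFun := by
    refine Continuous.subtype_mk (WeakDual.continuous_of_continuous_eval fun a => ?_) _
    exact continuous_eval_character (Φ.toHom a)

lemma specNdMap_apply (Φ : NdHom A B) (φ : characterSpace ℂ B) (a : A) :
    specNdMap Φ φ a = φ (Φ.toHom a) := rfl

lemma specNdMap_isCompact_preimage (Φ : NdHom A B) {K : Set (characterSpace ℂ A)}
    (hK : IsCompact K) : IsCompact (specNdMap Φ ⁻¹' K) := by
  have hcl : IsClosed (specNdMap Φ ⁻¹' K) := hK.isClosed.preimage (specNdMap Φ).continuous
  choose a ha using fun φ : characterSpace ℂ A => exists_character_ne_zero φ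
  let U : characterSpace ℂ A → Set (characterSpace ℂ A) := fun φ =>
    {ψ | ‖φ (a φ)‖ / 2 < ‖ψ (a φ)‖}
  obtain ⟨t, -, ht⟩ := hK.elim_nhds_subcover U fun φ _ => (isOpen_lt continuous_const
      (continuous_eval_character (a φ)).norm).mem_nhds (half_lt_self (norm_pos_iff.2 (ha φ)))
  refine IsCompact.of_isClosed_subset (t.isCompact_biUnion fun φ _ =>
    isCompact_character_le (Φ.toHom (a φ)) (half_pos (norm_pos_iff.2 (ha φ)))) hcl ?_
  intro ψ hψ
  obtain ⟨φ, hφ, h⟩ := Set.mem_iUnion₂.1 (ht hψ)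
  exact Set.mem_iUnion₂.2 ⟨φ, hφ, le_of_lt (show ‖φ (a φ)‖ / 2 < ‖ψ (Φ.toHom (a φ))‖ from h)⟩

end Spectrum

/-! ### Algebras of continuous functions -/

section Functions

variable {X : Type u} {Y : Type v} {Z : Type w}
  [TopologicalSpace X] [TopologicalSpace Y] [TopologicalSpace Z]

/-- The product of a bounded continuous function and one vanishing at infinity. -/
def mulC0 (g : X →ᵇ ℂ) (f : C₀(X, ℂ)) : C₀(X, ℂ) where
  toFun x := g x * f x
  continuous_toFun := g.continuous.mul f.continuous
  zero_at_infty' := by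
    refine squeeze_zero_norm (a := fun x => ‖g‖ * ‖f x‖) (fun x => ?_) ?_
    · rw [norm_mul]
      exact mul_le_mul_of_nonneg_right (g.norm_coe_le_norm x) (norm_nonneg _)
    · simpa using (f.zero_at_infty'.norm.const_mul ‖g‖)

/-- The multiplier of `C₀(X)` given by multiplication with a bounded continuous function. -/
def bcfMultiplier (g : X →ᵇ ℂ) : 𝓜(ℂ, C₀(X, ℂ)) :=
  multiplierOfCLM (LinearMap.mkContinuous
    { toFun := mulC0 g
      map_add' := fun f h => ZeroAtInftyContinuousMap.ext fun x => mul_add _ _ _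
      map_smul' := fun c f => ZeroAtInftyContinuousMap.ext fun x => mul_left_comm _ _ _ } ‖g‖
    fun f => by
      rw [← ZeroAtInftyContinuousMap.norm_toBCF_eq_norm,
        ← ZeroAtInftyContinuousMap.norm_toBCF_eq_norm]
      exact norm_mul_le g f.toBCF)
    fun f h => ZeroAtInftyContinuousMap.ext fun x => (mul_assoc _ _ _).symm

variable (X) in
/-- The canonical *-homomorphism `C_b(X) → 𝓜(C₀(X))`. -/
def bcfToMultiplier : (X →ᵇ ℂ) →⋆ₐ[ℂ] 𝓜(ℂ, C₀(X, ℂ)) where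
  toFun := bcfMultiplier
  map_one' := multiplier_ext fun f => ZeroAtInftyContinuousMap.ext fun x => one_mul _
  map_mul' g h := multiplier_ext fun f => ZeroAtInftyContinuousMap.ext fun x => mul_assoc _ _ _
  map_zero' := multiplier_ext fun f => ZeroAtInftyContinuousMap.ext fun x => zero_mul _
  map_add' g h := multiplier_ext fun f => ZeroAtInftyContinuousMap.ext fun x => add_mul _ _ _
  commutes' c := multiplier_ext fun f => by
    rw [Algebra.algebraMap_eq_smul_one c (A := 𝓜(ℂ, C₀(X, ℂ)))]
    exact ZeroAtInftyContinuousMap.ext fun x => rfl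
  map_star' g := multiplier_ext fun f => by
    rw [star_fst']
    refine ZeroAtInftyContinuousMap.ext fun x => ?_
    change star (g x) * f x = star (g x * star (f x))
    rw [star_mul', star_star]

/-- The Koopman operator `C_b(Y) → C_b(X)`, `f ↦ f ∘ T`. -/
def bcfKoopman (T : C(X, Y)) : (Y →ᵇ ℂ) →⋆ₐ[ℂ] (X →ᵇ ℂ) where
  toFun f := f.compContinuous T
  map_one' := rfl
  map_mul' _ _ := rfl
  map_zero' := rfl
  map_add' _ _ := rfl
  commutes' _ := rfl
  map_star' _ := rfl

variable (X) in
/-- The inclusion `C₀(X) → C_b(X)`. -/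
def zeroAtInftyToBCF : C₀(X, ℂ) →⋆ₙₐ[ℂ] (X →ᵇ ℂ) where
  toFun f := f.toBCF
  map_smul' _ _ := rfl
  map_zero' := rfl
  map_add' _ _ := rfl
  map_mul' _ _ := rfl
  map_star' _ := rfl

/-- The *-homomorphism `C₀(Y) → C_b(X) → 𝓜(C₀(X))`, `f ↦ f ∘ T`, for a continuous `T : X → Y`. -/
def zeroAtInftyKoopmanHom (T : C(X, Y)) : C₀(Y, ℂ) →⋆ₙₐ[ℂ] 𝓜(ℂ, C₀(X, ℂ)) :=
  (((bcfToMultiplier X).comp (bcfKoopman T) : (Y →ᵇ ℂ) →⋆ₐ[ℂ] 𝓜(ℂ, C₀(X, ℂ))) :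
    (Y →ᵇ ℂ) →⋆ₙₐ[ℂ] 𝓜(ℂ, C₀(X, ℂ))).comp (zeroAtInftyToBCF Y)

lemma zeroAtInftyKoopmanHom_apply (T : C(X, Y)) (f : C₀(Y, ℂ)) (g : C₀(X, ℂ)) (x : X) :
    (zeroAtInftyKoopmanHom T f).fst g x = f (T x) * g x := rfl

lemma isNondegenerate_zeroAtInftyKoopmanHom [LocallyCompactSpace Y] [T2Space Y] (T : C(X, Y)) :
    IsNondegenerate (zeroAtInftyKoopmanHom T) := by
  intro g
  rw [Metric.mem_closure_iff]
  intro ε hε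
  have h1 : ∀ᶠ x in Filter.cocompact X, ‖g x‖ < ε / 2 := by
    have := g.zero_at_infty'.norm
    rw [norm_zero] at this
    exact this.eventually (gt_mem_nhds (half_pos hε))
  obtain ⟨K, hK, hKg⟩ := Filter.mem_cocompact.1 h1
  obtain ⟨f, hf1, -, hfc, hf01⟩ := exists_continuous_one_zero_of_isCompact
    (hK.image T.continuous) isClosed_empty (Set.disjoint_empty _)
  let F : C₀(Y, ℂ) :=
    { toFun := fun y => (f y : ℂ)
      continuous_toFun := Complex.continuous_ofReal.comp f.continuous
      zero_at_infty' := by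
        have h2 : HasCompactSupport fun y => (f y : ℂ) :=
          hfc.comp_left (g := fun r : ℝ => (r : ℂ)) Complex.ofReal_zero
        exact h2.is_zero_at_infty }
  refine ⟨(zeroAtInftyKoopmanHom T F).fst g, Submodule.subset_span ⟨F, g, rfl⟩, ?_⟩
  refine lt_of_le_of_lt ?_ (half_lt_self hε)
  rw [dist_eq_norm, ← ZeroAtInftyContinuousMap.norm_toBCF_eq_norm,
    BoundedContinuousFunction.norm_le (half_pos hε).le]
  intro x
  change ‖g x - (f (T x) : ℂ) * g x‖ ≤ ε / 2
  by_cases hx : x ∈ K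
  · rw [hf1 ⟨x, hx, rfl⟩]
    simpa using (half_pos hε).le
  · have h3 : g x - (f (T x) : ℂ) * g x = ((1 - f (T x) : ℝ) : ℂ) * g x := by
      push_cast; ring
    rw [h3, norm_mul, Complex.norm_real, Real.norm_eq_abs]
    have h4 := hf01 (T x)
    have h5 : |1 - f (T x)| ≤ 1 := abs_le.2 ⟨by linarith [h4.2], by linarith [h4.1]⟩
    exact (mul_le_of_le_one_left (norm_nonneg _) h5).trans (le_of_lt (hKg hx))

/-- `C₀(T) : C₀(Y) → C₀(X)` as a multiplier-valued morphism, for `T : X → Y` continuous. -/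
def zeroAtInftyKoopmanMult [LocallyCompactSpace Y] [T2Space Y] (T : C(X, Y)) :
    MultHom C₀(Y, ℂ) C₀(X, ℂ) :=
  ⟨zeroAtInftyKoopmanHom T, isNondegenerate_zeroAtInftyKoopmanHom T⟩

/-- Under `C_b → 𝓜(C₀)`, the extension of `C₀(T)` to multiplier algebras is `C_b(T)`. -/
lemma zeroAtInftyKoopmanMult_mult [LocallyCompactSpace Y] [T2Space Y] (T : C(X, Y))
    (f : Y →ᵇ ℂ) :
    (zeroAtInftyKoopmanMult T).mult (bcfToMultiplier Y f) =
      bcfToMultiplier X (bcfKoopman T f) := by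
  have h : ((zeroAtInftyKoopmanMult T).mult (bcfToMultiplier Y f)).fst =
      (bcfToMultiplier X (bcfKoopman T f)).fst :=
    (isNondegenerate_zeroAtInftyKoopmanHom T).clm_ext fun a b => by
      refine ((isNondegenerate_zeroAtInftyKoopmanHom T).extension_apply _ a b).trans ?_
      exact ZeroAtInftyContinuousMap.ext fun x => mul_assoc _ _ _
  exact multiplier_ext fun x => congrArg (fun S : C₀(X, ℂ) →L[ℂ] C₀(X, ℂ) => S x) h

/-- `C₀(T) : C₀(Y) → C₀(X)`, `f ↦ f ∘ T`, for `T : X → Y` continuous and proper. -/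
def zeroAtInftyKoopmanNd [LocallyCompactSpace Y] [T2Space Y] (T : C(X, Y))
    (hT : ∀ K : Set Y, IsCompact K → IsCompact (T ⁻¹' K)) : NdHom C₀(Y, ℂ) C₀(X, ℂ) where
  toHom :=
    { toFun := fun f => f.comp ⟨T, CocompactMap.tendsto_of_forall_preimage hT⟩
      map_smul' := fun _ _ => rfl
      map_zero' := rfl
      map_add' := fun _ _ => rfl
      map_mul' := fun _ _ => rfl
      map_star' := fun _ => rfl }
  nondegenerate := by
    refine (isNondegenerate_zeroAtInftyKoopmanHom T).mono fun z hz => Submodule.span_mono ?_ hz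
    rintro _ ⟨a, b, rfl⟩
    exact ⟨a, b, ZeroAtInftyContinuousMap.ext fun x => rfl⟩

end Functions

/-! ### The categories -/

/-- Locally compact Hausdorff spaces, with continuous maps as morphisms. -/
structure LCH : Type (u + 1) where
  carrier : Type u
  [top : TopologicalSpace carrier]
  [lc : LocallyCompactSpace carrier]
  [t2 : T2Space carrier]

attribute [instance] LCH.top LCH.lc LCH.t2

instance : Category LCH.{u} where
  Hom X Y := C(X.carrier, Y.carrier)
  id X := ContinuousMap.id X.carrier
  comp f g := g.comp f

/-- Locally compact Hausdorff spaces, with continuous proper maps as morphisms. -/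
structure LCHpr : Type (u + 1) where
  carrier : Type u
  [top : TopologicalSpace carrier]
  [lc : LocallyCompactSpace carrier]
  [t2 : T2Space carrier]

attribute [instance] LCHpr.top LCHpr.lc LCHpr.t2

instance : Category LCHpr.{u} where
  Hom X Y := {T : C(X.carrier, Y.carrier) //
    ∀ K : Set Y.carrier, IsCompact K → IsCompact (T ⁻¹' K)}
  id X := ⟨ContinuousMap.id X.carrier, fun _ hK => hK⟩
  comp f g := ⟨g.1.comp f.1, fun K hK => f.2 _ (g.2 K hK)⟩

/-- Pointed compact Hausdorff spaces: the coslice category of compact Hausdorff spaces under a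
one-point space. -/
abbrev CHpt : Type (u + 1) := Under (CompHaus.of PUnit.{u + 1})

/-- Unital commutative C*-algebras, with unital *-homomorphisms. -/
structure CStarUnit : Type (u + 1) where
  carrier : Type u
  [str : CommCStarAlgebra carrier]

attribute [instance] CStarUnit.str

instance : Category CStarUnit.{u} where
  Hom A B := A.carrier →⋆ₐ[ℂ] B.carrier
  id A := StarAlgHom.id ℂ A.carrier
  comp f g := g.comp f

/-- Unital commutative C*-algebras with a distinguished unital *-homomorphism to `ℂ`, with the
unital *-homomorphisms that preserve it (the slice category over `ℂ`). -/
structure CStarInf : Type (u + 1) where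
  alg : CStarUnit.{u}
  pt : alg.carrier →⋆ₐ[ℂ] ℂ

instance : Category CStarInf.{u} where
  Hom A B := {Φ : A.alg.carrier →⋆ₐ[ℂ] B.alg.carrier // B.pt.comp Φ = A.pt}
  id A := ⟨StarAlgHom.id ℂ A.alg.carrier, rfl⟩
  comp {A B C} f g := ⟨g.1.comp f.1, by
    refine Eq.trans ?_ f.2
    exact congrArg (fun Φ : B.alg.carrier →⋆ₐ[ℂ] ℂ => Φ.comp f.1) g.2⟩

/-- Commutative C*-algebras, with non-degenerate *-homomorphisms. -/
structure CStarNd : Type (u + 1) where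
  carrier : Type u
  [str : NonUnitalCommCStarAlgebra carrier]

attribute [instance] CStarNd.str

instance : Category CStarNd.{u} where
  Hom A B := NdHom A.carrier B.carrier
  id A := NdHom.id A.carrier
  comp f g := g.comp f

/-- Commutative C*-algebras, with multiplier-valued morphisms. -/
structure CStarMult : Type (u + 1) where
  carrier : Type u
  [str : NonUnitalCommCStarAlgebra carrier]

attribute [instance] CStarMult.str

instance : Category CStarMult.{u} where
  Hom A B := MultHom A.carrier B.carrier
  id A := MultHom.id A.carrier
  comp f g := g.comp f
  id_comp f := MultHom.comp_id f
  comp_id f := MultHom.id_comp f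
  assoc f g h := (MultHom.comp_assoc h g f).symm

/-! ### Forgetful functors -/

lemma locallyCompact_of_compact (X : Type u) [TopologicalSpace X] [CompactSpace X] [T2Space X] :
    LocallyCompactSpace X := inferInstance

instance (X : CompHaus.{u}) : LocallyCompactSpace X :=
  @locallyCompact_of_compact X.toTop _ X.is_compact X.is_hausdorff

/-- Forgetting the distinguished point. -/
def forgetPt : CHpt.{u} ⥤ CompHaus.{u} := Under.forget _

/-- Compact Hausdorff spaces as locally compact Hausdorff spaces with proper maps. -/
def chToLCHpr : CompHaus.{u} ⥤ LCHpr.{u} where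
  obj X := ⟨X⟩
  map f := ⟨f.hom.hom, fun _ hK => (hK.isClosed.preimage f.hom.hom.continuous).isCompact⟩

/-- Compact Hausdorff spaces as locally compact Hausdorff spaces. -/
def chToLCH : CompHaus.{u} ⥤ LCH.{u} where
  obj X := ⟨X⟩
  map f := f.hom.hom

/-- Forgetting properness. -/
def lchprToLCH : LCHpr.{u} ⥤ LCH.{u} where
  obj X := ⟨X.carrier⟩
  map f := f.1

/-- Forgetting the distinguished *-homomorphism to `ℂ`. -/
def infToUnit : CStarInf.{u} ⥤ CStarUnit.{u} where
  obj A := A.alg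
  map f := f.1

/-- A unital *-homomorphism is non-degenerate. -/
def starAlgHomToNdHom {A B : Type u} [CommCStarAlgebra A] [CommCStarAlgebra B]
    (Φ : A →⋆ₐ[ℂ] B) : NdHom A B where
  toHom := (Φ : A →⋆ₙₐ[ℂ] B)
  nondegenerate b := subset_closure (Submodule.subset_span ⟨1, b, by
    change Φ 1 * b = b
    rw [map_one, one_mul]⟩)

/-- Forgetting the unit. -/
def unitToNd : CStarUnit.{u} ⥤ CStarNd.{u} where
  obj A := ⟨A.carrier⟩
  map f := starAlgHomToNdHom f

/-- Viewing a morphism `A → B` as multiplier-valued. -/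
def ndToMult : CStarNd.{u} ⥤ CStarMult.{u} where
  obj A := ⟨A.carrier⟩
  map f := f.toMultHom
  map_comp f g := MultHom.ext (NdHom.toMultHom_comp_toHom g f).symm

/-- Viewing a unital *-homomorphism `A → B` as multiplier-valued, through `B → 𝓜(B)`. -/
def unitToMult : CStarUnit.{u} ⥤ CStarMult.{u} where
  obj A := ⟨A.carrier⟩
  map f := (starAlgHomToNdHom f).toMultHom
  map_comp f g := MultHom.ext (NdHom.toMultHom_comp_toHom (starAlgHomToNdHom g)
    (starAlgHomToNdHom f)).symm

/-! ### Compactification, unitization and multiplier functors -/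

/-- The Alexandroff compactification, pointed at infinity. -/
def alex : LCHpr.{u} ⥤ CHpt.{u} where
  obj X := Under.mk (Y := CompHaus.of (OnePoint X.carrier))
    (CompHausLike.ofHom _ (ContinuousMap.const PUnit.{u + 1} (OnePoint.infty : OnePoint X.carrier)))
  map {X Y} f := Under.homMk (CompHausLike.ofHom _
    (⟨OnePoint.map f.1, OnePoint.continuous_map f.1.continuous (by
      rw [Filter.coclosedCompact_eq_cocompact, Filter.coclosedCompact_eq_cocompact]
      exact CocompactMap.tendsto_of_forall_preimage f.2)⟩ :
      C(OnePoint X.carrier, OnePoint Y.carrier))) rfl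
  map_id X := by
    ext x
    exact congrFun OnePoint.map_id x
  map_comp f g := by
    ext x
    exact congrFun (OnePoint.map_comp g.1 f.1) x

/-- The coordinate *-homomorphism `a + c1 ↦ c` on the unitization `A ⊕ ℂ`. -/
def unitizationCoord (A : Type u) [NonUnitalCommCStarAlgebra A] : Unitization ℂ A →⋆ₐ[ℂ] ℂ where
  __ := Unitization.fstHom ℂ A
  map_star' _ := rfl

lemma unitizationCoord_starMap {A B : Type u} [NonUnitalCommCStarAlgebra A]
    [NonUnitalCommCStarAlgebra B] (Φ : A →⋆ₙₐ[ℂ] B) :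
    (unitizationCoord B).comp (Unitization.starMap Φ) = unitizationCoord A :=
  StarAlgHom.ext fun a => by
    change (Unitization.starMap Φ a).fst = a.fst
    simp [Unitization.algebraMap_eq_inl]

/-- The unitization functor `A ↦ A ⊕ ℂ`, `Φ ↦ (a + c1 ↦ Φ(a) + c1)`. -/
def unitization : CStarNd.{u} ⥤ CStarInf.{u} where
  obj A := ⟨⟨Unitization ℂ A.carrier⟩, unitizationCoord A.carrier⟩
  map f := ⟨Unitization.starMap f.toHom, unitizationCoord_starMap f.toHom⟩
  map_id _ := Subtype.ext Unitization.starMap_id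
  map_comp _ _ := Subtype.ext Unitization.starMap_comp

/-- The multiplier algebra functor. -/
def mult : CStarMult.{u} ⥤ CStarUnit.{u} where
  obj A := ⟨𝓜(ℂ, A.carrier)⟩
  map f := f.mult
  map_id _ := MultHom.mult_id
  map_comp f g := MultHom.mult_comp g f

/-! ### Function algebra functors -/

/-- `X ↦ C(X)` on compact Hausdorff spaces, with Koopman operators. -/
def cFun : CompHaus.{u} ⥤ CStarUnit.{u}ᵒᵖ where
  obj X := op ⟨C(X, ℂ)⟩
  map f := Quiver.Hom.op (ContinuousMap.compStarAlgHom' ℂ ℂ f.hom.hom)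

/-- `X ↦ C(X)` on pointed compact Hausdorff spaces; the distinguished *-homomorphism is
evaluation at the distinguished point. -/
def cFunPt : CHpt.{u} ⥤ CStarInf.{u}ᵒᵖ where
  obj X := op
    { alg := ⟨C(X.right, ℂ)⟩
      pt := ContinuousMap.evalStarAlgHom ℂ ℂ (X.hom.hom.hom PUnit.unit) }
  map {X Y} f := Quiver.Hom.op ⟨ContinuousMap.compStarAlgHom' ℂ ℂ f.right.hom.hom,
    StarAlgHom.ext fun a => by
      have h : f.right.hom.hom (X.hom.hom.hom PUnit.unit) = Y.hom.hom.hom PUnit.unit :=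
        congrArg (fun g : CompHaus.of PUnit.{u + 1} ⟶ Y.right => g.hom.hom PUnit.unit) (Under.w f)
      exact congrArg a h⟩

/-- `X ↦ C₀(X)` on locally compact Hausdorff spaces with proper maps. -/
def c0FunPr : LCHpr.{u} ⥤ CStarNd.{u}ᵒᵖ where
  obj X := op ⟨C₀(X.carrier, ℂ)⟩
  map f := Quiver.Hom.op (zeroAtInftyKoopmanNd f.1 f.2)

/-- `X ↦ C₀(X)` on locally compact Hausdorff spaces with continuous maps. -/
def c0Fun : LCH.{u} ⥤ CStarMult.{u}ᵒᵖ where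
  obj X := op ⟨C₀(X.carrier, ℂ)⟩
  map f := Quiver.Hom.op (zeroAtInftyKoopmanMult f)
  map_id _ := congrArg Quiver.Hom.op (MultHom.ext (NonUnitalStarAlgHom.ext fun _ =>
    multiplier_ext fun _ => rfl))
  map_comp f g := congrArg Quiver.Hom.op (MultHom.ext (NonUnitalStarAlgHom.ext fun a =>
    (zeroAtInftyKoopmanMult_mult f (bcfKoopman g a.toBCF)).symm))

/-- `X ↦ C_b(X)` on locally compact Hausdorff spaces. -/
def cbFun : LCH.{u} ⥤ CStarUnit.{u}ᵒᵖ where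
  obj X := op ⟨X.carrier →ᵇ ℂ⟩
  map f := Quiver.Hom.op (bcfKoopman f)

/-! ### Spectrum functors

The spectrum of a commutative C*-algebra `A` is its character space (non-zero multiplicative
functionals with the topology of pointwise convergence on `A`). It is identified above with the set
of non-degenerate *-homomorphisms `A → ℂ` and with the set of multiplier-valued morphisms `A → ℂ`;
on morphisms, `Spec` is precomposition in the respective category. -/

open WeakDual in
/-- The Gelfand spectrum of a unital commutative C*-algebra. -/
def specUnit : CStarUnit.{u}ᵒᵖ ⥤ CompHaus.{u} where
  obj A := CompHaus.of (characterSpace ℂ A.unop.carrier)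
  map f := CompHausLike.ofHom _ (CharacterSpace.compContinuousMap f.unop)

open WeakDual in
/-- The spectrum of a unital commutative C*-algebra with a distinguished *-homomorphism to `ℂ`,
pointed at this *-homomorphism. -/
def specInf : CStarInf.{u}ᵒᵖ ⥤ CHpt.{u} where
  obj A := Under.mk (Y := CompHaus.of (characterSpace ℂ A.unop.alg.carrier))
    (CompHausLike.ofHom _ (ContinuousMap.const PUnit.{u + 1}
      (CharacterSpace.equivAlgHom.symm A.unop.pt.toAlgHom)))
  map {A B} f := Under.homMk (CompHausLike.ofHom _ (CharacterSpace.compContinuousMap f.unop.1)) (by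
    ext x
    refine CharacterSpace.ext fun a => ?_
    exact congrArg (fun Φ : B.unop.alg.carrier →⋆ₐ[ℂ] ℂ => Φ a) f.unop.2)

open WeakDual in
/-- The spectrum of a commutative C*-algebra. -/
def specNd : CStarNd.{u}ᵒᵖ ⥤ LCHpr.{u} where
  obj A := ⟨characterSpace ℂ A.unop.carrier⟩
  map f := ⟨specNdMap f.unop, fun _ hK => specNdMap_isCompact_preimage f.unop hK⟩

open WeakDual in
/-- The spectrum of a commutative C*-algebra, on multiplier-valued morphisms. -/
def specMult : CStarMult.{u}ᵒᵖ ⥤ LCH.{u} where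
  obj A := ⟨characterSpace ℂ A.unop.carrier⟩
  map f := specMultMap f.unop
  map_id _ := specMultMap_id
  map_comp f g := specMultMap_comp f.unop g.unop

/-- The Stone-Čech compactification functor, `β = Spec ∘ C_b`. -/
def stoneCech : LCH.{u} ⥤ CompHaus.{u} := cbFun ⋙ specUnit

/-- A duality of categories: functors `F : Cᵒᵖ ⥤ D` and `G : D ⥤ Cᵒᵖ` whose two composites are
naturally isomorphic to the identity functors. -/
def IsDuality {C : Type v} [Category.{w} C] {D : Type u} [Category.{x} D]
    (F : Cᵒᵖ ⥤ D) (G : D ⥤ Cᵒᵖ) : Prop :=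
  Nonempty (F ⋙ G ≅ 𝟭 Cᵒᵖ) ∧ Nonempty (G ⋙ F ≅ 𝟭 D)

end GelfandDualities

end

open GelfandDualities

noncomputable section

namespace GelfandDualities

/-! Unital Gelfand duality is the input: `A → C(Spec A)` is bijective and every character of `C(K)`,
with `K` compact Hausdorff, is evaluation at a point. The non-unital dualities are reduced to it by
adding a point.

On the space side, `C₀(X) ⊕ ℂ` is `C(X ∪ {∞})` (`unitizationExtend_bijective`). On the algebra side,
a character of `A ⊕ ℂ` is determined by its restriction to `A`, which is either zero or a character,
so `Spec (A ⊕ ℂ)` is `Spec A ∪ {∞}` (`unitizationCharacterHomeo`). Discarding the point at infinity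
gives `A ≅ C₀(Spec A)` (`gelfandZeroAtInfty_bijective`) and `X ≅ Spec C₀(X)` (`evalCharacterHomeo`).
The same two identifications are the left square of the first diagram.

For multiplier-valued morphisms the objects and isomorphisms are the same; only naturality is new.
It rests on the formula `(λ ∘ Φ)(a) λ(b) = λ(Φ(a)b)` of `specMultFun_apply` and on non-degeneracy,
by which operators agreeing on all `Φ(a)b` are equal. The right square needs one more computation,
`𝓜(C₀(X)) = C_b(X)` (`bcfToMultiplier_bijective`); its other isomorphisms follow formally from this
and the dualities.

A duality is an equivalence, hence `C`, `C₀` and `Spec` are full and faithful. The functors `C_b`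
and `β` inherit faithfulness through natural isomorphisms. Fullness of the forgetful functors from
unital algebras is transported along `Spec` from spaces, where it says that continuous maps between
compact Hausdorff spaces are proper. -/

/-! ### The non-unital Gelfand transform and the one-point compactification -/

section Extension

variable {X : Type u} [TopologicalSpace X]

/-- The extension of a function vanishing at infinity to the one-point compactification. -/
def zeroAtInftyExtend [T2Space X] (f : C₀(X, ℂ)) : C(OnePoint X, ℂ) :=
  OnePoint.continuousMapMk f.toContinuousMap 0 (by
    rw [Filter.coclosedCompact_eq_cocompact]
    exact f.zero_at_infty')

variable (X) in
/-- Extension by zero to the one-point compactification, as a *-homomorphism. -/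
def zeroAtInftyExtendHom [T2Space X] : C₀(X, ℂ) →⋆ₙₐ[ℂ] C(OnePoint X, ℂ) where
  toFun := zeroAtInftyExtend
  map_smul' c f := by
    ext p
    induction p using OnePoint.rec with
    | infty => exact (mul_zero c).symm
    | coe x => rfl
  map_zero' := by
    ext p
    induction p using OnePoint.rec with
    | infty => rfl
    | coe x => rfl
  map_add' f g := by
    ext p
    induction p using OnePoint.rec with
    | infty => exact (add_zero 0).symm
    | coe x => rfl
  map_mul' f g := by
    ext p
    induction p using OnePoint.rec with
    | infty => exact (mul_zero 0).symm
    | coe x => rfl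
  map_star' f := by
    ext p
    induction p using OnePoint.rec with
    | infty => exact (star_zero ℂ).symm
    | coe x => rfl

variable (X) in
/-- The *-homomorphism `C₀(X) ⊕ ℂ → C(X ∪ {∞})`. -/
def unitizationExtend [T2Space X] : Unitization ℂ C₀(X, ℂ) →⋆ₐ[ℂ] C(OnePoint X, ℂ) :=
  Unitization.starLift (zeroAtInftyExtendHom X)

lemma unitizationExtend_infty [T2Space X] (a : Unitization ℂ C₀(X, ℂ)) :
    unitizationExtend X a OnePoint.infty = a.fst := add_zero _

lemma unitizationExtend_coe [T2Space X] (a : Unitization ℂ C₀(X, ℂ)) (x : X) :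
    unitizationExtend X a (x : OnePoint X) = a.fst + a.snd x := rfl

/-- The scalar part is the value at `∞`, and what remains after subtracting it is determined by its
values on `X`. Conversely `f - f(∞)` restricts to a function vanishing at infinity. -/
lemma unitizationExtend_bijective [T2Space X] :
    Function.Bijective (unitizationExtend X) := by
  constructor
  · intro a b h
    have h1 : a.fst = b.fst := by
      rw [← unitizationExtend_infty, h, unitizationExtend_infty]
    refine Unitization.ext h1 (ZeroAtInftyContinuousMap.ext fun x => ?_)
    have h2 := congrArg (fun f : C(OnePoint X, ℂ) => f (x : OnePoint X)) h
    simp only [unitizationExtend_coe, h1] at h2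
    exact add_left_cancel h2
  · intro f
    let g : C₀(X, ℂ) :=
      { toFun := fun x => f (x : OnePoint X) - f OnePoint.infty
        continuous_toFun := (f.continuous.comp OnePoint.continuous_coe).sub continuous_const
        zero_at_infty' := by
          -- Continuity at `∞` is exactly convergence to `f ∞` along the cocompact filter of `X`.
          have h : Filter.Tendsto (fun x : X => f (x : OnePoint X)) (Filter.cocompact X)
              (nhds (f OnePoint.infty)) := by
            rw [← Filter.coclosedCompact_eq_cocompact]
            exact (OnePoint.continuous_iff f).1 f.continuous |>.1
          simpa using h.sub_const (f OnePoint.infty) }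
    refine ⟨Unitization.inl (f OnePoint.infty) + Unitization.inr g, ?_⟩
    ext p
    induction p using OnePoint.rec with
    | infty => rw [unitizationExtend_infty]; simp
    | coe x =>
      rw [unitizationExtend_coe]
      simp [g]

end Extension

/-! ### Characters of the unitization, and the Gelfand transform into `C₀` -/

section Gelfand

open WeakDual

variable (A : Type u) [NonUnitalCommCStarAlgebra A]

/-- The Gelfand transform `A → C₀(Spec A)`. -/
def gelfandZeroAtInfty : A →⋆ₙₐ[ℂ] C₀(characterSpace ℂ A, ℂ) where
  toFun a :=
    { toFun := fun φ => φ a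
      continuous_toFun := continuous_eval_character a
      zero_at_infty' := by
        rw [Metric.tendsto_nhds]
        intro ε hε
        refine Filter.mem_cocompact.2 ⟨_, isCompact_character_le a hε, fun φ hφ => ?_⟩
        simpa using hφ }
  map_smul' c a := ZeroAtInftyContinuousMap.ext fun φ => map_smul φ c a
  map_zero' := ZeroAtInftyContinuousMap.ext fun φ => map_zero φ
  map_add' a b := ZeroAtInftyContinuousMap.ext fun φ => map_add φ a b
  map_mul' a b := ZeroAtInftyContinuousMap.ext fun φ => map_mul φ a b
  map_star' a := ZeroAtInftyContinuousMap.ext fun φ => character_star φ a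

variable {A}

/-- The character of the unitization of `A` corresponding to a point of `Spec A ∪ {∞}`. -/
def unitizationCharacter (p : OnePoint (characterSpace ℂ A)) :
    characterSpace ℂ (Unitization ℂ A) :=
  CharacterSpace.equivAlgHom.symm (p.elim (unitizationCoord A).toAlgHom
    fun φ => Unitization.lift (CharacterSpace.toNonUnitalAlgHom φ))

/-- A single formula for finite points and `∞`: the Gelfand transform of the `A`-part, extended by
`0`, supplies the second summand. Continuity in `p` is then immediate. -/
lemma unitizationCharacter_apply (p : OnePoint (characterSpace ℂ A)) (a : Unitization ℂ A) :
    unitizationCharacter p a = a.fst + zeroAtInftyExtend (gelfandZeroAtInfty A a.snd) p := by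
  induction p using OnePoint.rec with
  | infty => exact (add_zero _).symm
  | coe φ => rfl

lemma continuous_unitizationCharacter :
    Continuous (unitizationCharacter : OnePoint (characterSpace ℂ A) → _) := by
  refine Continuous.subtype_mk (WeakDual.continuous_of_continuous_eval fun a => ?_) _
  change Continuous fun p => unitizationCharacter p a
  simp_rw [unitizationCharacter_apply]
  exact continuous_const.add (zeroAtInftyExtend _).continuous

/-- A character of `A ⊕ ℂ` fixes scalars, so it is known from its restriction to `A`. The zero
restriction corresponds to `∞`, and a non-zero one is a character of `A`. Since characters are
non-zero, the two cases do not overlap. -/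
lemma unitizationCharacter_bijective :
    Function.Bijective (unitizationCharacter : OnePoint (characterSpace ℂ A) → _) := by
  have hinr : ∀ (p : OnePoint (characterSpace ℂ A)) (a : A),
      unitizationCharacter p (a : Unitization ℂ A) = p.elim 0 fun φ => φ a := fun p a =>
    (unitizationCharacter_apply p a).trans (zero_add _)
  constructor
  · intro p q h
    have h1 : ∀ a : A, (p.elim 0 fun φ => φ a) = (q.elim 0 fun φ => φ a : ℂ) := fun a => by
      rw [← hinr, h, hinr]
    induction p using OnePoint.rec with
    | infty =>
      induction q using OnePoint.rec with
      | infty => rfl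
      | coe ψ =>
        obtain ⟨a, ha⟩ := exists_character_ne_zero ψ
        exact absurd (h1 a).symm ha
    | coe φ =>
      induction q using OnePoint.rec with
      | infty =>
        obtain ⟨a, ha⟩ := exists_character_ne_zero φ
        exact absurd (h1 a) ha
      | coe ψ => exact congrArg _ (CharacterSpace.ext h1)
  · intro χ
    have hsum : ∀ u : Unitization ℂ A, χ u = u.fst + χ (u.snd : Unitization ℂ A) := fun u => by
      conv_lhs => rw [← Unitization.inl_fst_add_inr_snd_eq u]
      rw [map_add]
      congr 1
      exact AlgHomClass.commutes χ u.fst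
    by_cases h : ∀ a : A, χ (a : Unitization ℂ A) = 0
    · refine ⟨OnePoint.infty, CharacterSpace.ext fun u => ?_⟩
      rw [hsum, h]
      exact unitizationCharacter_apply _ _
    · push Not at h
      obtain ⟨a, ha⟩ := h
      -- The restriction of `χ` to `A`; it is non-zero at `a`, hence a point of `Spec A`.
      let ψ : A →ₙₐ[ℂ] ℂ := (CharacterSpace.toNonUnitalAlgHom χ).comp
        (Unitization.inrNonUnitalAlgHom ℂ A)
      have hc : Continuous ψ := (map_continuous χ).comp Unitization.continuous_inr
      let φ : characterSpace ℂ A := ⟨⟨(ψ : A →ₗ[ℂ] ℂ), hc⟩,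
        fun h => ha (congrArg (fun f : WeakDual ℂ A => f a) h), map_mul ψ⟩
      refine ⟨(φ : OnePoint _), CharacterSpace.ext fun u => ?_⟩
      rw [hsum]
      exact unitizationCharacter_apply _ _

variable (A) in
/-- The spectrum of the unitization is the one-point compactification of the spectrum. -/
def unitizationCharacterHomeo :
    OnePoint (characterSpace ℂ A) ≃ₜ characterSpace ℂ (Unitization ℂ A) :=
  Continuous.homeoOfEquivCompactToT2 (f := Equiv.ofBijective _ unitizationCharacter_bijective)
    continuous_unitizationCharacter

/-- The unital Gelfand theorem is applied to `A ⊕ ℂ`, whose characters are the points of `Spec A ∪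
{∞}`. The elements of `A` are those on which the character at `∞` vanishes, and they match the
functions vanishing at `∞`. -/
lemma gelfandZeroAtInfty_bijective : Function.Bijective (gelfandZeroAtInfty A) := by
  constructor
  · rw [injective_iff_map_eq_zero]
    intro a ha
    have h : gelfandTransform ℂ (Unitization ℂ A) (a : Unitization ℂ A) = 0 := by
      ext χ
      obtain ⟨p, rfl⟩ := unitizationCharacter_bijective.2 χ
      refine (unitizationCharacter_apply p a).trans ?_
      change 0 + zeroAtInftyExtendHom _ (gelfandZeroAtInfty A a) p = 0
      rw [ha, map_zero, zero_add]
      rfl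
    exact Unitization.inr_injective ((gelfandTransform_bijective (Unitization ℂ A)).1
      (h.trans (map_zero _).symm))
  · intro f
    -- `f` is extended by `0` at `∞` and moved to `Spec (A ⊕ ℂ)`, where it is the transform of some
    -- `u`.
    obtain ⟨u, hu⟩ := (gelfandTransform_bijective (Unitization ℂ A)).2
      ((zeroAtInftyExtend f).comp ((unitizationCharacterHomeo A).symm : C(_, _)))
    have h : ∀ p, unitizationCharacter p u = zeroAtInftyExtend f p := fun p => by
      refine (congrArg (fun g : C(characterSpace ℂ (Unitization ℂ A), ℂ) =>
        g (unitizationCharacterHomeo A p)) hu).trans ?_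
      exact congrArg (zeroAtInftyExtend f) ((unitizationCharacterHomeo A).symm_apply_apply p)
    -- The value at `∞` is the scalar part of `u`, so `u` lies in `A`.
    have h0 : u.fst = 0 := by
      have := h OnePoint.infty
      rw [unitizationCharacter_apply] at this
      exact (add_zero _).symm.trans this
    refine ⟨u.snd, ZeroAtInftyContinuousMap.ext fun φ => ?_⟩
    have := h φ
    rw [unitizationCharacter_apply, h0, zero_add] at this
    exact this

end Gelfand

/-! ### Evaluation characters -/

section Eval

open WeakDual

variable {X : Type u} [TopologicalSpace X] [LocallyCompactSpace X] [T2Space X]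

/-- Urysohn functions. Vanishing off `U` recovers the topology of `X` from `C₀(X)`; the norm bound
keeps the function attached to a multiplier bounded. -/
lemma exists_zeroAtInfty_eq_one {U : Set X} (hU : IsOpen U) {x : X} (hx : x ∈ U) :
    ∃ f : C₀(X, ℂ), f x = 1 ∧ (∀ y ∉ U, f y = 0) ∧ ‖f‖ ≤ 1 := by
  obtain ⟨f, hf1, hf0, hfc, hf01⟩ := exists_continuous_one_zero_of_isCompact
    (isCompact_singleton (x := x)) hU.isClosed_compl (by simpa using hx)
  refine ⟨{ toFun := fun y => (f y : ℂ)
            continuous_toFun := Complex.continuous_ofReal.comp f.continuous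
            zero_at_infty' := ?_ }, ?_, fun y hy => ?_, ?_⟩
  · have h2 : HasCompactSupport fun y => (f y : ℂ) :=
      hfc.comp_left (g := fun r : ℝ => (r : ℂ)) Complex.ofReal_zero
    exact h2.is_zero_at_infty
  · change (f x : ℂ) = 1
    rw [hf1 rfl]; simp
  · change (f y : ℂ) = 0
    rw [hf0 hy]; simp
  · rw [← ZeroAtInftyContinuousMap.norm_toBCF_eq_norm,
      BoundedContinuousFunction.norm_le zero_le_one]
    intro y
    change ‖(f y : ℂ)‖ ≤ 1
    rw [Complex.norm_real, Real.norm_eq_abs]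
    exact abs_le.2 ⟨by linarith [(hf01 y).1], (hf01 y).2⟩

/-- Evaluation at a point, as a character of `C₀(X)`. -/
def evalCharacter (x : X) : characterSpace ℂ C₀(X, ℂ) :=
  ⟨(ContinuousLinearMap.mk
    { toFun := fun f : C₀(X, ℂ) => f x
      map_add' := fun _ _ => rfl
      map_smul' := fun _ _ => rfl }
    ((continuous_eval_const (F := X →ᵇ ℂ) x).comp
      ZeroAtInftyContinuousMap.isometry_toBCF.continuous) : C₀(X, ℂ) →L[ℂ] ℂ), by
    obtain ⟨f, hf, -⟩ := exists_zeroAtInfty_eq_one isOpen_univ (Set.mem_univ x)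
    refine ⟨fun h => ?_, fun _ _ => rfl⟩
    have h0 : f x = 0 := congrArg (fun φ : WeakDual ℂ C₀(X, ℂ) => φ f) h
    exact one_ne_zero (hf.symm.trans h0)⟩

/-- A Urysohn function `f` at `x` that vanishes off `U` gives the weak-* open set `{φ | φ f ≠ 0}`,
whose preimage in `X` lies inside `U`. -/
lemma isInducing_evalCharacter :
    Topology.IsInducing (evalCharacter : X → characterSpace ℂ C₀(X, ℂ)) := by
  have hc : Continuous (evalCharacter : X → characterSpace ℂ C₀(X, ℂ)) :=
    Continuous.subtype_mk (WeakDual.continuous_of_continuous_eval fun f => f.continuous) _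
  refine Topology.isInducing_iff_nhds.2 fun x => le_antisymm (hc.tendsto x).le_comap ?_
  intro s hs
  obtain ⟨U, hUs, hU, hx⟩ := mem_nhds_iff.1 hs
  obtain ⟨f, hf1, hf0, -⟩ := exists_zeroAtInfty_eq_one hU hx
  refine ⟨{φ | φ f ≠ 0}, (isOpen_ne_fun (continuous_eval_character f)
    continuous_const).mem_nhds ?_, fun y hy => hUs ?_⟩
  · exact fun h => one_ne_zero (hf1.symm.trans h)
  · by_contra hyU
    exact hy (hf0 y hyU)

/-- A character of `C₀(X)` extends to `C₀(X) ⊕ ℂ ≅ C(X ∪ {∞})`, where it is evaluation at some point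
`p`. The case `p = ∞` is excluded because the character would vanish on `C₀(X)`. Injectivity comes
from the inducing property, `X` being Hausdorff. -/
lemma evalCharacter_bijective :
    Function.Bijective (evalCharacter : X → characterSpace ℂ C₀(X, ℂ)) := by
  refine ⟨isInducing_evalCharacter.injective, fun φ => ?_⟩
  let e := StarAlgEquiv.ofBijective (unitizationExtend X) unitizationExtend_bijective
  let χ := unitizationCharacter (φ : OnePoint (characterSpace ℂ C₀(X, ℂ)))
  obtain ⟨p, hp⟩ := (CharacterSpace.homeoEval (OnePoint X) ℂ).surjective
    (CharacterSpace.compContinuousMap (e.symm : C(OnePoint X, ℂ) →⋆ₐ[ℂ] _) χ)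
  have h : ∀ f : C₀(X, ℂ), zeroAtInftyExtend f p = φ f := fun f => by
    have h1 := congrArg (fun ψ : characterSpace ℂ C(OnePoint X, ℂ) =>
      ψ (e (f : Unitization ℂ C₀(X, ℂ)))) hp
    have h2 : e (f : Unitization ℂ C₀(X, ℂ)) p = χ (e.symm (e (f : Unitization ℂ C₀(X, ℂ)))) := h1
    rw [e.symm_apply_apply] at h2
    have h3 : χ (f : Unitization ℂ C₀(X, ℂ)) = φ f := zero_add _
    rw [h3] at h2
    exact (zero_add _).symm.trans h2
  induction p using OnePoint.rec with
  | infty =>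
    obtain ⟨f, hf⟩ := exists_character_ne_zero φ
    exact absurd (h f).symm hf
  | coe x => exact ⟨x, CharacterSpace.ext h⟩

variable (X) in
/-- A locally compact Hausdorff space is the spectrum of its algebra of continuous functions
vanishing at infinity. -/
def evalCharacterHomeo : X ≃ₜ characterSpace ℂ C₀(X, ℂ) :=
  (Equiv.ofBijective _ evalCharacter_bijective).toHomeomorphOfIsInducing isInducing_evalCharacter

/-! ### Multipliers of `C₀(X)` -/

/-- With `f x` a function in `C₀(X)` equal to `1` at `x`, a multiplier `m` can only be
multiplication by `g(x) = m(f x)(x)`. The work is to see that this `g` is continuous and bounded. -/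
lemma bcfToMultiplier_bijective : Function.Bijective (bcfToMultiplier X) := by
  choose f hf1 _ hf using fun x : X => exists_zeroAtInfty_eq_one isOpen_univ (Set.mem_univ x)
  constructor
  · intro g h hgh
    ext x
    have h1 : g x * f x x = h x * f x x := congrArg
      (fun m : 𝓜(ℂ, C₀(X, ℂ)) => m.fst (f x) x) hgh
    rwa [hf1, mul_one, mul_one] at h1
  · intro m
    -- `m(f x * k)` is computed in two ways, with `m` moved past either factor, and evaluated at
    -- `x`.
    have hm : ∀ (k : C₀(X, ℂ)) x, m.fst k x = m.fst (f x) x * k x := fun k x => by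
      have h1 : m.fst (f x * k) x = m.fst (f x) x * k x := by rw [fst_mul]; rfl
      have h2 : m.fst (f x * k) x = f x x * m.fst k x := by rw [mul_fst_comm]; rfl
      rw [← h1, h2, hf1, one_mul]
    let g : X →ᵇ ℂ := BoundedContinuousFunction.ofNormedAddCommGroup
      (fun x => m.fst (f x) x) (by
        rw [continuous_iff_continuousAt]
        intro x
        -- Near `x` the choice of `f y` can be replaced by the fixed function `f x`, which does not
        -- vanish there; so `g` is locally a quotient of continuous functions.
        have h1 : (fun y => m.fst (f x) y / f x y) =ᶠ[nhds x] fun y => m.fst (f y) y := by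
          have h2 : f x x ≠ 0 := by rw [hf1]; exact one_ne_zero
          have h3 : IsOpen {y | f x y ≠ 0} := isOpen_ne_fun (f x).continuous continuous_const
          filter_upwards [h3.mem_nhds h2] with y hy
          rw [hm (f x) y, mul_div_assoc, div_self hy, mul_one]
        refine ContinuousAt.congr ((m.fst (f x)).continuous.continuousAt.div
          (f x).continuous.continuousAt ?_) h1
        exact fun h => one_ne_zero ((hf1 x).symm.trans h)) ‖m‖ (fun x => by
        have h1 : ‖m.fst (f x) x‖ ≤ ‖m.fst (f x)‖ := by
          rw [← ZeroAtInftyContinuousMap.norm_toBCF_eq_norm]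
          exact (m.fst (f x)).toBCF.norm_coe_le_norm x
        refine h1.trans ((m.fst.le_opNorm _).trans ?_)
        rw [DoubleCentralizer.norm_fst]
        exact mul_le_of_le_one_right (norm_nonneg _) (hf x))
    exact ⟨g, multiplier_ext fun k => ZeroAtInftyContinuousMap.ext fun x => (hm k x).symm⟩

end Eval

end GelfandDualities

end

noncomputable section

namespace GelfandDualities

/-! ### Isomorphisms in the categories of algebras and spaces -/

/-- A surjective *-homomorphism is non-degenerate. -/
def NdHom.ofSurjective {A : Type u} {B : Type v} [NonUnitalCommCStarAlgebra A]
    [NonUnitalCommCStarAlgebra B] (Φ : A →⋆ₙₐ[ℂ] B) (h : Function.Surjective Φ) : NdHom A B where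
  toHom := Φ
  nondegenerate := (dense_span_mul B).mono fun z hz => by
    refine Submodule.span_mono ?_ hz
    rintro _ ⟨a, b, rfl⟩
    obtain ⟨a, rfl⟩ := h a
    exact ⟨a, b, rfl⟩

/-- A bijective *-homomorphism is an isomorphism of commutative C*-algebras. -/
def CStarNd.isoOfBijective {A B : CStarNd.{u}} (Φ : A.carrier →⋆ₙₐ[ℂ] B.carrier)
    (h : Function.Bijective Φ) : A ≅ B where
  hom := NdHom.ofSurjective Φ h.2
  inv := NdHom.ofSurjective
    ((StarAlgEquiv.ofBijective Φ h).symm : B.carrier →⋆ₙₐ[ℂ] A.carrier)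
    (StarAlgEquiv.ofBijective Φ h).symm.surjective
  hom_inv_id := NdHom.ext (NonUnitalStarAlgHom.ext
    (StarAlgEquiv.ofBijective Φ h).symm_apply_apply)
  inv_hom_id := NdHom.ext (NonUnitalStarAlgHom.ext
    (StarAlgEquiv.ofBijective Φ h).apply_symm_apply)

/-- A bijective unital *-homomorphism is an isomorphism of unital commutative C*-algebras. -/
def CStarUnit.isoOfBijective {A B : CStarUnit.{u}} (Φ : A.carrier →⋆ₐ[ℂ] B.carrier)
    (h : Function.Bijective Φ) : A ≅ B where
  hom := Φ
  inv := ((StarAlgEquiv.ofBijective Φ h).symm : B.carrier →⋆ₐ[ℂ] A.carrier)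
  hom_inv_id := StarAlgHom.ext (StarAlgEquiv.ofBijective Φ h).symm_apply_apply
  inv_hom_id := StarAlgHom.ext (StarAlgEquiv.ofBijective Φ h).apply_symm_apply

/-- A bijective unital *-homomorphism preserving the distinguished characters is an isomorphism. -/
def CStarInf.isoOfBijective {A B : CStarInf.{u}} (Φ : A.alg.carrier →⋆ₐ[ℂ] B.alg.carrier)
    (h : Function.Bijective Φ) (hpt : B.pt.comp Φ = A.pt) : A ≅ B where
  hom := ⟨Φ, hpt⟩
  inv := ⟨((StarAlgEquiv.ofBijective Φ h).symm : B.alg.carrier →⋆ₐ[ℂ] A.alg.carrier),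
    StarAlgHom.ext fun b => by
      rw [← hpt]
      exact congrArg B.pt ((StarAlgEquiv.ofBijective Φ h).apply_symm_apply b)⟩
  hom_inv_id := Subtype.ext (StarAlgHom.ext (StarAlgEquiv.ofBijective Φ h).symm_apply_apply)
  inv_hom_id := Subtype.ext (StarAlgHom.ext (StarAlgEquiv.ofBijective Φ h).apply_symm_apply)

/-- A homeomorphism is an isomorphism in the category of proper maps. -/
def LCHpr.isoOfHomeo {X Y : LCHpr.{u}} (e : X.carrier ≃ₜ Y.carrier) : X ≅ Y where
  hom := ⟨e, fun _ hK => e.isCompact_preimage.2 hK⟩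
  inv := ⟨e.symm, fun _ hK => e.symm.isCompact_preimage.2 hK⟩
  hom_inv_id := Subtype.ext (ContinuousMap.ext e.symm_apply_apply)
  inv_hom_id := Subtype.ext (ContinuousMap.ext e.apply_symm_apply)

/-- A homeomorphism is an isomorphism in the category of continuous maps. -/
def LCH.isoOfHomeo {X Y : LCH.{u}} (e : X.carrier ≃ₜ Y.carrier) : X ≅ Y where
  hom := (e : C(X.carrier, Y.carrier))
  inv := (e.symm : C(Y.carrier, X.carrier))
  hom_inv_id := ContinuousMap.ext e.symm_apply_apply
  inv_hom_id := ContinuousMap.ext e.apply_symm_apply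

/-! ### The dualities -/

open WeakDual

section Naturality

variable {A : Type u} {B : Type v} [NonUnitalCommCStarAlgebra A] [NonUnitalCommCStarAlgebra B]

/-- Naturality of the Gelfand transform with respect to multiplier-valued morphisms. -/
lemma gelfandZeroAtInfty_naturality (Φ : MultHom A B) :
    (zeroAtInftyKoopmanMult (specMultMap Φ)).comp
        (NdHom.ofSurjective _ (gelfandZeroAtInfty_bijective (A := A)).2).toMultHom =
      (NdHom.ofSurjective _ (gelfandZeroAtInfty_bijective (A := B)).2).toMultHom.comp Φ := by
  refine MultHom.ext (NonUnitalStarAlgHom.ext fun a => ?_)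
  set Γ := (NdHom.ofSurjective _ (gelfandZeroAtInfty_bijective (A := B)).2).toMultHom
  change (zeroAtInftyKoopmanMult (specMultMap Φ)).mult
    (DoubleCentralizer.coeHom (gelfandZeroAtInfty A a)) = Γ.mult (Φ.toHom a)
  rw [MultHom.mult_coe]
  -- Non-degeneracy of the Gelfand transform reduces equality to functions of the form `Γ(b)c`. At a
  -- point `ψ` both sides are then compared by `specMultFun_apply`.
  have h : (zeroAtInftyKoopmanHom (specMultMap Φ) (gelfandZeroAtInfty A a)).fst =
      (Γ.mult (Φ.toHom a)).fst := Γ.nondegenerate.clm_ext fun b c => by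
    refine Eq.trans ?_ (Γ.nondegenerate.extension_apply (Φ.toHom a) b c).symm
    refine ZeroAtInftyContinuousMap.ext fun ψ => ?_
    change specMultFun Φ ψ a * (ψ b * c ψ) = ψ ((Φ.toHom a).fst b) * c ψ
    rw [← mul_assoc, specMultFun_apply]
  exact multiplier_ext fun x => congrArg (fun S : C₀(characterSpace ℂ B, ℂ) →L[ℂ] _ => S x) h

/-- Both characters give the same result after multiplication by a non-zero value `φ b`, which
cancels. -/
lemma specMultFun_toMultHom (Φ : NdHom A B) (φ : characterSpace ℂ B) :
    specMultFun Φ.toMultHom φ = specNdMap Φ φ := by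
  obtain ⟨b, hb⟩ := exists_character_ne_zero φ
  refine CharacterSpace.ext fun a => mul_right_cancel₀ hb ?_
  rw [specMultFun_apply]
  exact map_mul φ (Φ.toHom a) b

lemma specMultFun_koopman {X : Type u} {Y : Type v} [TopologicalSpace X] [TopologicalSpace Y]
    [LocallyCompactSpace X] [LocallyCompactSpace Y] [T2Space X] [T2Space Y] (T : C(X, Y)) (x : X) :
    specMultFun (zeroAtInftyKoopmanMult T) (evalCharacter x) = evalCharacter (T x) := by
  obtain ⟨b, hb⟩ := exists_character_ne_zero (evalCharacter x)
  refine CharacterSpace.ext fun a => mul_right_cancel₀ hb ?_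
  rw [specMultFun_apply]
  rfl

end Naturality

/-- `C(Spec A) ≅ A`. -/
def specUnitCFunIso : specUnit.{u} ⋙ cFun ≅ 𝟭 CStarUnit.{u}ᵒᵖ :=
  NatIso.ofComponents (fun A => (CStarUnit.isoOfBijective (A := A.unop)
    (B := ⟨C(characterSpace ℂ A.unop.carrier, ℂ)⟩)
    (gelfandStarTransform A.unop.carrier : A.unop.carrier →⋆ₐ[ℂ] _)
    (gelfandStarTransform A.unop.carrier).bijective).op)
    fun _ => Quiver.Hom.unop_inj (StarAlgHom.ext fun _ => rfl)

/-- `Spec C(X) ≅ X`. -/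
def cFunSpecUnitIso : cFun.{u} ⋙ specUnit ≅ 𝟭 CompHaus.{u} :=
  -- Evaluation maps `X` to `Spec C(X)`, so the isomorphism is built in that direction and then
  -- inverted.
  (NatIso.ofComponents (fun X => CompHausLike.isoOfHomeo (CharacterSpace.homeoEval X ℂ))
    fun _ => rfl : 𝟭 CompHaus.{u} ≅ cFun.{u} ⋙ specUnit).symm

/-- The Gelfand transform of a pointed algebra. -/
def gelfandInfIso (A : CStarInf.{u}) : A ≅ ⟨⟨C(characterSpace ℂ A.alg.carrier, ℂ)⟩,
    ContinuousMap.evalStarAlgHom ℂ ℂ (CharacterSpace.equivAlgHom.symm A.pt.toAlgHom)⟩ :=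
  CStarInf.isoOfBijective
    (B := ⟨⟨C(characterSpace ℂ A.alg.carrier, ℂ)⟩, ContinuousMap.evalStarAlgHom ℂ ℂ
      (CharacterSpace.equivAlgHom.symm A.pt.toAlgHom)⟩)
    (gelfandStarTransform A.alg.carrier : A.alg.carrier →⋆ₐ[ℂ] _)
    (gelfandStarTransform A.alg.carrier).bijective (StarAlgHom.ext fun _ => rfl)

/-- `C(Spec A) ≅ A`, pointed. -/
def specInfCFunPtIso : specInf.{u} ⋙ cFunPt ≅ 𝟭 CStarInf.{u}ᵒᵖ :=
  NatIso.ofComponents (fun A => (gelfandInfIso A.unop).op)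
    fun f => Quiver.Hom.unop_inj (Subtype.ext (gelfandStarTransform_naturality f.unop.1).symm)

/-- `Spec C(X) ≅ X`, pointed. -/
def cFunPtSpecInfIso : cFunPt.{u} ⋙ specInf ≅ 𝟭 CHpt.{u} :=
  (NatIso.ofComponents (fun X => Under.isoMk
      (CompHausLike.isoOfHomeo (CharacterSpace.homeoEval X.right ℂ)) rfl)
    fun _ => rfl : 𝟭 CHpt.{u} ≅ cFunPt.{u} ⋙ specInf).symm

/-- `C₀(Spec A) ≅ A`, for non-degenerate *-homomorphisms. -/
def specNdC0FunPrIso : specNd.{u} ⋙ c0FunPr ≅ 𝟭 CStarNd.{u}ᵒᵖ :=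
  NatIso.ofComponents (fun A => (CStarNd.isoOfBijective (A := A.unop)
    (B := ⟨C₀(characterSpace ℂ A.unop.carrier, ℂ)⟩)
    (gelfandZeroAtInfty A.unop.carrier) gelfandZeroAtInfty_bijective).op)
    fun _ => Quiver.Hom.unop_inj (NdHom.ext (NonUnitalStarAlgHom.ext fun _ => rfl))

/-- `Spec C₀(X) ≅ X`, for proper maps. -/
def c0FunPrSpecNdIso : c0FunPr.{u} ⋙ specNd ≅ 𝟭 LCHpr.{u} :=
  (NatIso.ofComponents (fun X => LCHpr.isoOfHomeo (evalCharacterHomeo X.carrier))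
    fun _ => rfl : 𝟭 LCHpr.{u} ≅ c0FunPr.{u} ⋙ specNd).symm

/-- `C₀(Spec A) ≅ A`, for multiplier-valued morphisms. -/
def specMultC0FunIso : specMult.{u} ⋙ c0Fun ≅ 𝟭 CStarMult.{u}ᵒᵖ :=
  NatIso.ofComponents (fun A => (ndToMult.mapIso (CStarNd.isoOfBijective (A := ⟨A.unop.carrier⟩)
    (B := ⟨C₀(characterSpace ℂ A.unop.carrier, ℂ)⟩)
    (gelfandZeroAtInfty A.unop.carrier) gelfandZeroAtInfty_bijective)).op)
    fun f => Quiver.Hom.unop_inj (gelfandZeroAtInfty_naturality f.unop)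

/-- `Spec C₀(X) ≅ X`, for continuous maps. -/
def c0FunSpecMultIso : c0Fun.{u} ⋙ specMult ≅ 𝟭 LCH.{u} :=
  (NatIso.ofComponents (fun X => LCH.isoOfHomeo (evalCharacterHomeo X.carrier))
    fun f => ContinuousMap.ext fun x => (specMultFun_koopman f x).symm :
    𝟭 LCH.{u} ≅ c0Fun.{u} ⋙ specMult).symm

lemma isDuality_unit : IsDuality specUnit.{u} cFun.{u} :=
  ⟨⟨specUnitCFunIso⟩, ⟨cFunSpecUnitIso⟩⟩

lemma isDuality_inf : IsDuality specInf.{u} cFunPt.{u} :=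
  ⟨⟨specInfCFunPtIso⟩, ⟨cFunPtSpecInfIso⟩⟩

lemma isDuality_nd : IsDuality specNd.{u} c0FunPr.{u} :=
  ⟨⟨specNdC0FunPrIso⟩, ⟨c0FunPrSpecNdIso⟩⟩

lemma isDuality_mult : IsDuality specMult.{u} c0Fun.{u} :=
  ⟨⟨specMultC0FunIso⟩, ⟨c0FunSpecMultIso⟩⟩

/-! ### Dualities as equivalences -/

section Duality

variable {C : Type v} [Category.{w} C] {D : Type u} [Category.{x} D] {F : Cᵒᵖ ⥤ D} {G : D ⥤ Cᵒᵖ}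

/-- The two isomorphisms of a duality are not assumed to satisfy the triangle identities;
`Equivalence.mk` corrects the unit so that they hold. -/
lemma IsDuality.isEquivalence_left (h : IsDuality F G) : F.IsEquivalence := by
  obtain ⟨⟨e⟩, ⟨e'⟩⟩ := h
  exact (CategoryTheory.Equivalence.mk F G e.symm e').isEquivalence_functor

lemma IsDuality.isEquivalence_right (h : IsDuality F G) : G.IsEquivalence := by
  obtain ⟨⟨e⟩, ⟨e'⟩⟩ := h
  exact (CategoryTheory.Equivalence.mk F G e.symm e').isEquivalence_inverse

lemma IsDuality.full_faithful_left (h : IsDuality F G) : F.Full ∧ F.Faithful :=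
  have := h.isEquivalence_left
  ⟨inferInstance, inferInstance⟩

lemma IsDuality.full_faithful_right (h : IsDuality F G) : G.Full ∧ G.Faithful :=
  have := h.isEquivalence_right
  ⟨inferInstance, inferInstance⟩

end Duality

/-! ### The squares of the first diagram -/

section Unitization

variable {A : Type u} {B : Type v} [NonUnitalCommCStarAlgebra A] [NonUnitalCommCStarAlgebra B]

lemma starMap_fst (Φ : A →⋆ₙₐ[ℂ] B) (a : Unitization ℂ A) :
    (Unitization.starMap Φ a).fst = a.fst := by
  simp [Unitization.algebraMap_eq_inl]

lemma starMap_snd (Φ : A →⋆ₙₐ[ℂ] B) (a : Unitization ℂ A) :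
    (Unitization.starMap Φ a).snd = Φ a.snd := by
  simp [Unitization.algebraMap_eq_inl]

lemma unitizationExtend_naturality {X : Type u} {Y : Type v} [TopologicalSpace X]
    [TopologicalSpace Y] [T2Space X] [T2Space Y] [LocallyCompactSpace Y] (T : C(X, Y))
    (hT : ∀ K : Set Y, IsCompact K → IsCompact (T ⁻¹' K)) (a : Unitization ℂ C₀(Y, ℂ))
    (p : OnePoint X) : unitizationExtend Y a (OnePoint.map T p) =
      unitizationExtend X (Unitization.starMap (zeroAtInftyKoopmanNd T hT).toHom a) p := by
  induction p using OnePoint.rec with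
  | infty => rw [unitizationExtend_infty, starMap_fst]; exact unitizationExtend_infty a
  | coe x => rw [unitizationExtend_coe, starMap_fst, starMap_snd]; rfl

lemma unitizationCharacter_naturality (Φ : NdHom A B) (p : OnePoint (characterSpace ℂ B))
    (a : Unitization ℂ A) : unitizationCharacter (OnePoint.map (specNdMap Φ) p) a =
      unitizationCharacter p (Unitization.starMap Φ.toHom a) := by
  rw [unitizationCharacter_apply, unitizationCharacter_apply, starMap_fst, starMap_snd]
  induction p using OnePoint.rec with
  | infty => rfl
  | coe φ => rfl

end Unitization

/-- `C(X ∪ {∞}) ≅ C₀(X) ⊕ ℂ`. -/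
def alexCFunPtIso : alex.{u} ⋙ cFunPt ≅ c0FunPr ⋙ unitization.op :=
  NatIso.ofComponents (fun X => (CStarInf.isoOfBijective
    (A := unitization.obj ⟨C₀(X.carrier, ℂ)⟩) (B := (cFunPt.obj (alex.obj X)).unop)
    (unitizationExtend X.carrier) unitizationExtend_bijective
    (StarAlgHom.ext unitizationExtend_infty)).op)
    fun f => Quiver.Hom.unop_inj (Subtype.ext (StarAlgHom.ext fun a =>
      ContinuousMap.ext fun p => unitizationExtend_naturality f.1 f.2 a p))

/-- `Spec(A) ∪ {∞} ≅ Spec(A ⊕ ℂ)`. -/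
def specNdAlexIso : specNd.{u} ⋙ alex ≅ unitization.op ⋙ specInf :=
  NatIso.ofComponents (fun A => Under.isoMk
      (CompHausLike.isoOfHomeo (unitizationCharacterHomeo A.unop.carrier)) rfl)
    fun f => Under.UnderMorphism.ext (ConcreteCategory.hom_ext _ _ fun p =>
      CharacterSpace.ext fun a => unitizationCharacter_naturality f.unop p a)

/-- `C₀` commutes with forgetting properness. -/
def lchprToLCHC0FunIso : lchprToLCH.{u} ⋙ c0Fun ≅ c0FunPr ⋙ ndToMult.op :=
  NatIso.ofComponents (fun _ => Iso.refl _) fun f => by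
    -- The two functors agree on objects by definition and the components are identities, so only
    -- the images of `f` are compared.
    refine (Category.comp_id _).trans (Eq.trans ?_ (Category.id_comp _).symm)
    exact Quiver.Hom.unop_inj (MultHom.ext (NonUnitalStarAlgHom.ext fun _ =>
      multiplier_ext fun _ => rfl))

/-- `Spec` commutes with forgetting properness. -/
def specNdLchprToLCHIso : specNd.{u} ⋙ lchprToLCH ≅ ndToMult.op ⋙ specMult :=
  NatIso.ofComponents (fun _ => Iso.refl _) fun f => by
    refine (Category.comp_id _).trans (Eq.trans ?_ (Category.id_comp _).symm)
    exact ContinuousMap.ext fun φ => (specMultFun_toMultHom f.unop φ).symm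

/-- `𝓜(C₀(X)) ≅ C_b(X)`. -/
def c0FunMultIso : c0Fun.{u} ⋙ mult.op ≅ cbFun :=
  (NatIso.ofComponents (fun X => (CStarUnit.isoOfBijective
      (A := ⟨X.carrier →ᵇ ℂ⟩) (B := ⟨𝓜(ℂ, C₀(X.carrier, ℂ))⟩)
      (bcfToMultiplier X.carrier) bcfToMultiplier_bijective).op)
    fun f => Quiver.Hom.unop_inj (StarAlgHom.ext fun g => zeroAtInftyKoopmanMult_mult f g))

/-- `C_b(Spec A) ≅ 𝓜(A)`. -/
def specMultCbFunIso : specMult.{u} ⋙ cbFun ≅ mult.op :=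
  -- The chain is `C_b(Spec A) ≅ 𝓜(C₀(Spec A)) ≅ 𝓜(A)`.
  Functor.isoWhiskerLeft specMult c0FunMultIso.symm ≪≫ (Functor.associator _ _ _).symm ≪≫
    Functor.isoWhiskerRight specMultC0FunIso mult.op ≪≫ Functor.leftUnitor _

/-- `C(βX) ≅ C_b(X)`. -/
def stoneCechCFunIso : stoneCech.{u} ⋙ cFun ≅ cbFun :=
  Functor.associator _ _ _ ≪≫ Functor.isoWhiskerLeft cbFun specUnitCFunIso ≪≫
    Functor.rightUnitor _

/-- `β Spec(A) ≅ Spec 𝓜(A)`. -/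
def specMultStoneCechIso : specMult.{u} ⋙ stoneCech ≅ mult.op ⋙ specUnit :=
  (Functor.associator specMult cbFun specUnit).symm ≪≫
    Functor.isoWhiskerRight specMultCbFunIso specUnit

/-! ### The squares of the second diagram -/

/-- On a compact space every continuous function vanishes at infinity. -/
def compactToZeroAtInfty (X : Type u) [TopologicalSpace X] [CompactSpace X] :
    C(X, ℂ) →⋆ₙₐ[ℂ] C₀(X, ℂ) where
  toFun := ZeroAtInftyContinuousMap.ContinuousMap.liftZeroAtInfty
  map_smul' _ _ := rfl
  map_zero' := rfl
  map_add' _ _ := rfl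
  map_mul' _ _ := rfl
  map_star' _ := rfl

/-- `C₀(X) ≅ C(X)` for compact `X`. -/
def chToLCHprC0FunPrIso : chToLCHpr.{u} ⋙ c0FunPr ≅ cFun ⋙ unitToNd.op :=
  NatIso.ofComponents (fun X => (CStarNd.isoOfBijective (A := ⟨C(X, ℂ)⟩) (B := ⟨C₀(X, ℂ)⟩)
    (compactToZeroAtInfty X) ZeroAtInftyContinuousMap.ContinuousMap.liftZeroAtInfty.bijective).op)
    fun _ => Quiver.Hom.unop_inj (NdHom.ext (NonUnitalStarAlgHom.ext fun _ => rfl))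

/-- `Spec` commutes with forgetting the unit. -/
def specUnitChToLCHprIso : specUnit.{u} ⋙ chToLCHpr ≅ unitToNd.op ⋙ specNd :=
  NatIso.ofComponents (fun A => LCHpr.isoOfHomeo (Homeomorph.refl
    (characterSpace ℂ A.unop.carrier))) fun _ => rfl



/-- `C₀(X) ≅ C(X)` for compact `X`, in the multiplier-valued category. -/
def chToLCHC0FunIso : chToLCH.{u} ⋙ c0Fun ≅ cFun ⋙ unitToMult.op :=
  Functor.associator chToLCHpr lchprToLCH c0Fun ≪≫
    Functor.isoWhiskerLeft chToLCHpr lchprToLCHC0FunIso ≪≫ (Functor.associator _ _ _).symm ≪≫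
    Functor.isoWhiskerRight chToLCHprC0FunPrIso ndToMult.op ≪≫ Functor.associator _ _ _

/-- `Spec` commutes with viewing unital *-homomorphisms as multiplier-valued morphisms. -/
def specUnitChToLCHIso : specUnit.{u} ⋙ chToLCH ≅ unitToMult.op ⋙ specMult :=
  (Functor.associator specUnit chToLCHpr lchprToLCH).symm ≪≫
    Functor.isoWhiskerRight specUnitChToLCHprIso lchprToLCH ≪≫ Functor.associator _ _ _ ≪≫
    Functor.isoWhiskerLeft unitToNd.op specNdLchprToLCHIso ≪≫ (Functor.associator _ _ _).symm

/-! ### Faithfulness and fullness -/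

lemma alex_faithful : alex.{u}.Faithful where
  map_injective {X Y _ _} h := Subtype.ext (ContinuousMap.ext fun x =>
    OnePoint.coe_injective (congrArg
      (fun k : alex.obj X ⟶ alex.obj Y => k.right.hom.hom (x : OnePoint X.carrier)) h))

lemma lchprToLCH_faithful : lchprToLCH.{u}.Faithful where
  map_injective h := Subtype.ext h

/-- The extension `𝓜(Φ)` restricts to `Φ` on `A`. -/
lemma mult_faithful : mult.{u}.Faithful where
  map_injective {A B _ _} h := MultHom.ext (NonUnitalStarAlgHom.ext fun a => by
    rw [← MultHom.mult_coe, ← MultHom.mult_coe]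
    exact congrArg (fun Φ : 𝓜(ℂ, A.carrier) →⋆ₐ[ℂ] 𝓜(ℂ, B.carrier) =>
      Φ (DoubleCentralizer.coeHom a)) h)

/-- `C_b` is isomorphic to `𝓜 ∘ C₀`, a composite of faithful functors. -/
lemma cbFun_faithful : cbFun.{u}.Faithful :=
  have := isDuality_mult.{u}.full_faithful_right.2
  have := mult_faithful.{u}
  Functor.Faithful.of_iso c0FunMultIso

/-- Since `C ∘ β ≅ C_b` is faithful, so is its first factor `β`. -/
lemma stoneCech_faithful : stoneCech.{u}.Faithful :=
  have := cbFun_faithful.{u}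
  Functor.Faithful.of_comp_iso stoneCechCFunIso

lemma unitization_faithful : unitization.{u}.Faithful where
  map_injective {A B f g} h := NdHom.ext (NonUnitalStarAlgHom.ext fun a => by
    have h1 := congrArg (fun k : unitization.obj A ⟶ unitization.obj B =>
      (k.1 (a : Unitization ℂ A.carrier)).snd) h
    change (Unitization.starMap f.toHom (a : Unitization ℂ A.carrier)).snd =
      (Unitization.starMap g.toHom (a : Unitization ℂ A.carrier)).snd at h1
    simpa only [Unitization.starMap_inr, Unitization.snd_inr] using h1)

lemma coeHom_injective (A : Type u) [NonUnitalCommCStarAlgebra A] :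
    Function.Injective (DoubleCentralizer.coeHom : A →⋆ₙₐ[ℂ] 𝓜(ℂ, A)) := fun a b h =>
  eq_of_forall_mul_eq fun x => by
    rw [mul_comm x, mul_comm x]
    exact congrArg (fun m : 𝓜(ℂ, A) => m.fst x) h

lemma ndToMult_faithful : ndToMult.{u}.Faithful where
  map_injective {A B _ _} h := NdHom.ext (NonUnitalStarAlgHom.ext fun a =>
    coeHom_injective B.carrier (congrArg (fun Φ : MultHom A.carrier B.carrier => Φ.toHom a) h))

lemma infToUnit_faithful : infToUnit.{u}.Faithful where
  map_injective h := Subtype.ext h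

lemma chToLCHpr_faithful : chToLCHpr.{u}.Faithful where
  map_injective {X Y _ _} h := ConcreteCategory.hom_ext _ _ fun x =>
    congrArg (fun k : chToLCHpr.obj X ⟶ chToLCHpr.obj Y => k.1 x) h

lemma chToLCHpr_full : chToLCHpr.{u}.Full where
  map_surjective f := ⟨CompHausLike.ofHom _ f.1, rfl⟩

lemma chToLCH_faithful : chToLCH.{u}.Faithful where
  map_injective {X Y _ _} h := ConcreteCategory.hom_ext _ _ fun x =>
    congrArg (fun k : C(X, Y) => k x) h

lemma chToLCH_full : chToLCH.{u}.Full where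
  map_surjective f := ⟨CompHausLike.ofHom _ f, rfl⟩

/-- `Spec` turns this functor into the inclusion of compact spaces, which is full and faithful. As
`Spec` is itself full and faithful on both sides, the property passes back to algebras. -/
lemma unitToNd_op_full_faithful : unitToNd.{u}.op.Full ∧ unitToNd.{u}.op.Faithful := by
  obtain ⟨_, _⟩ := isDuality_unit.{u}.full_faithful_left
  obtain ⟨_, _⟩ := isDuality_nd.{u}.full_faithful_left
  have := chToLCHpr_full.{u}
  have := chToLCHpr_faithful.{u}
  exact ⟨Functor.Full.of_comp_faithful_iso specUnitChToLCHprIso.symm,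
    Functor.Faithful.of_comp_iso specUnitChToLCHprIso.symm⟩

lemma unitToMult_op_full_faithful : unitToMult.{u}.op.Full ∧ unitToMult.{u}.op.Faithful := by
  obtain ⟨_, _⟩ := isDuality_unit.{u}.full_faithful_left
  obtain ⟨_, _⟩ := isDuality_mult.{u}.full_faithful_left
  have := chToLCH_full.{u}
  have := chToLCH_faithful.{u}
  exact ⟨Functor.Full.of_comp_faithful_iso specUnitChToLCHIso.symm,
    Functor.Faithful.of_comp_iso specUnitChToLCHIso.symm⟩

end GelfandDualities

end

theorem theorem2p3 :
    -- the multiplier functor sends a morphism `Φ : A → B`, i.e. a non-degenerate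
    -- *-homomorphism `A → 𝓜(B)`, to its unique unital extension `𝓜(A) → 𝓜(B)`
    (∀ (A B : CStarMult.{u}) (Φ : A ⟶ B) (Ψ : 𝓜(ℂ, A.carrier) →⋆ₐ[ℂ] 𝓜(ℂ, B.carrier)),
      (∀ a : A.carrier, Ψ (DoubleCentralizer.coeHom a) = MultHom.toHom Φ a) ↔ Ψ = mult.map Φ) ∧
    -- composition of multiplier-valued morphisms is characterised by `𝓜(Ψ ∘ Φ) = 𝓜(Ψ) ∘ 𝓜(Φ)`
    (∀ (A B C : CStarMult.{u}) (Φ : A ⟶ B) (Ψ : B ⟶ C) (Χ : A ⟶ C),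
      mult.map Χ = mult.map Φ ≫ mult.map Ψ ↔ Χ = Φ ≫ Ψ) ∧
    -- the vertical functors are full and faithful
    (cFunPt.{u}.Full ∧ cFunPt.{u}.Faithful) ∧ (specInf.{u}.Full ∧ specInf.{u}.Faithful) ∧
    (c0FunPr.{u}.Full ∧ c0FunPr.{u}.Faithful) ∧ (specNd.{u}.Full ∧ specNd.{u}.Faithful) ∧
    (c0Fun.{u}.Full ∧ c0Fun.{u}.Faithful) ∧ (specMult.{u}.Full ∧ specMult.{u}.Faithful) ∧
    (cFun.{u}.Full ∧ cFun.{u}.Faithful) ∧ (specUnit.{u}.Full ∧ specUnit.{u}.Faithful) ∧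
    -- horizontal functors of the first diagram
    alex.{u}.Faithful ∧ lchprToLCH.{u}.Faithful ∧ cbFun.{u}.Faithful ∧ stoneCech.{u}.Faithful ∧
    unitization.{u}.op.Faithful ∧ ndToMult.{u}.op.Faithful ∧ mult.{u}.op.Faithful ∧
    -- horizontal functors of the second diagram
    forgetPt.{u}.Faithful ∧ (chToLCHpr.{u}.Full ∧ chToLCHpr.{u}.Faithful) ∧
    (chToLCH.{u}.Full ∧ chToLCH.{u}.Faithful) ∧
    infToUnit.{u}.op.Faithful ∧ (unitToNd.{u}.op.Full ∧ unitToNd.{u}.op.Faithful) ∧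
    (unitToMult.{u}.op.Full ∧ unitToMult.{u}.op.Faithful) ∧
    -- each vertical pair is a duality of categories
    IsDuality specInf.{u} cFunPt.{u} ∧ IsDuality specNd.{u} c0FunPr.{u} ∧
    IsDuality specMult.{u} c0Fun.{u} ∧ IsDuality specUnit.{u} cFun.{u} ∧
    -- first diagram, left square
    Nonempty (alex.{u} ⋙ cFunPt ≅ c0FunPr ⋙ unitization.op) ∧
    Nonempty (specNd.{u} ⋙ alex ≅ unitization.op ⋙ specInf) ∧
    -- first diagram, middle square (also the right square of the second diagram)
    Nonempty (lchprToLCH.{u} ⋙ c0Fun ≅ c0FunPr ⋙ ndToMult.op) ∧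
    Nonempty (specNd.{u} ⋙ lchprToLCH ≅ ndToMult.op ⋙ specMult) ∧
    -- first diagram, right square with its diagonal
    Nonempty (c0Fun.{u} ⋙ mult.op ≅ cbFun) ∧
    Nonempty (specMult.{u} ⋙ cbFun ≅ mult.op) ∧
    Nonempty (stoneCech.{u} ⋙ cFun ≅ cbFun) ∧
    Nonempty (cbFun.{u} ⋙ specUnit ≅ stoneCech) ∧
    Nonempty (stoneCech.{u} ⋙ cFun ≅ c0Fun ⋙ mult.op) ∧
    Nonempty (specMult.{u} ⋙ stoneCech ≅ mult.op ⋙ specUnit) ∧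
    -- second diagram, left square
    Nonempty (forgetPt.{u} ⋙ cFun ≅ cFunPt ⋙ infToUnit.op) ∧
    Nonempty (specInf.{u} ⋙ forgetPt ≅ infToUnit.op ⋙ specUnit) ∧
    -- second diagram, middle square
    Nonempty (chToLCHpr.{u} ⋙ c0FunPr ≅ cFun ⋙ unitToNd.op) ∧
    Nonempty (specUnit.{u} ⋙ chToLCHpr ≅ unitToNd.op ⋙ specNd) ∧
    -- second diagram, bent arrows
    Nonempty (chToLCHpr.{u} ⋙ lchprToLCH ≅ chToLCH) ∧
    Nonempty (unitToNd.{u}.op ⋙ ndToMult.op ≅ unitToMult.op) ∧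
    Nonempty (chToLCH.{u} ⋙ c0Fun ≅ cFun ⋙ unitToMult.op) ∧
    Nonempty (specUnit.{u} ⋙ chToLCH ≅ unitToMult.op ⋙ specMult) := by
  have h1 := isDuality_inf.{u}
  have h2 := isDuality_nd.{u}
  have h3 := isDuality_mult.{u}
  have h4 := isDuality_unit.{u}
  have := alex_faithful.{u}
  have := unitization_faithful.{u}
  have := ndToMult_faithful.{u}
  have := mult_faithful.{u}
  have := infToUnit_faithful.{u}
  refine ⟨fun A B Φ Ψ => ⟨fun h => (MultHom.mult_unique Φ h).symm, ?_⟩,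
    -- Faithfulness of the multiplier functor is what makes the composite unique.
    fun A B C Φ Ψ Χ => ⟨fun h => mult.map_injective (h.trans (mult.map_comp Φ Ψ).symm), ?_⟩,
    h1.full_faithful_right, h1.full_faithful_left, h2.full_faithful_right, h2.full_faithful_left,
    h3.full_faithful_right, h3.full_faithful_left, h4.full_faithful_right, h4.full_faithful_left,
    inferInstance, lchprToLCH_faithful, cbFun_faithful, stoneCech_faithful,
    inferInstance, inferInstance, inferInstance,
    inferInstanceAs (Under.forget _).Faithful, ⟨chToLCHpr_full, chToLCHpr_faithful⟩,
    ⟨chToLCH_full, chToLCH_faithful⟩, inferInstance, unitToNd_op_full_faithful,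
    unitToMult_op_full_faithful, h1, h2, h3, h4,
    ⟨alexCFunPtIso⟩, ⟨specNdAlexIso⟩, ⟨lchprToLCHC0FunIso⟩, ⟨specNdLchprToLCHIso⟩,
    ⟨c0FunMultIso⟩, ⟨specMultCbFunIso⟩, ⟨stoneCechCFunIso⟩, ⟨Iso.refl _⟩,
    ⟨stoneCechCFunIso ≪≫ c0FunMultIso.symm⟩, ⟨specMultStoneCechIso⟩,
    -- The squares that forget base points commute strictly, as do the composites of forgetful
    -- functors.
    ⟨Iso.refl _⟩, ⟨Iso.refl _⟩, ⟨chToLCHprC0FunPrIso⟩, ⟨specUnitChToLCHprIso⟩,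
    ⟨Iso.refl _⟩, ⟨Iso.refl _⟩, ⟨chToLCHC0FunIso⟩, ⟨specUnitChToLCHIso⟩⟩
  · rintro rfl
    exact MultHom.mult_coe Φ
  · rintro rfl
    exact mult.map_comp Φ Ψ
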